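/- Let $\Gamma$ be an i.c.c. group (an infinite discrete group, not necessarily countable, in which every conjugacy class other than $\{1\}$ is infinite). Let $M=\mathcal L(\Gamma)\subset B(\ell^2(\Gamma))$ be the von Neumann algebra generated by the left regular representation $(u_g)_{g\in\Gamma}$, with its canonical trace $\tau(x)=\langle x\delta_1,\delta_1\rangle$ and $\|x\|_2=\tau(x^*x)^{1/2}$. Call $M$ full if every norm-bounded net $(x_i)$ in $M$ with $\lim_i\|x_ia-ax_i\|_2=0$ for all $a\in M$ satisfies $\lim_i\|x_i-\tau(x_i)1\|_2=0$. Call $\Gamma$ inner amenable if there is a conjugation-invariant mean $m$ on $\ell^\infty(\Gamma)$ with $m(1_{\{1\}})=0$. For a projection $p\in M$, a finite set $K\subset\Gamma$ and a constant $\kappa>0$ consider the property $$(\ast)\qquad \|x\|_2\le\kappa\sum_{g\in K}\|p(xu_g-u_gx)p\|_2\quad\text{for all } x\in pMp \text{ with } \tau(x)=0 .$$ If $M$ is full, then for every $\varepsilon>0$ there are a projection $p\in M$ with $\|1-p\|_2<\varepsilon$, a finite set $K\subset\Gamma$ and a constant $\kappa>0$ such that $(\ast)$ holds. Moreover, there are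 a finite set $K\subset\Gamma$ and a constant $\kappa>0$ such that $(\ast)$ holds with $p=1$ if and only if $\Gamma$ is not inner amenable (this equivalence does not require $M$ to be full). -/

import Mathlib

open scoped ENNReal Topology

universe u

namespace GroupFactor

noncomputable section

/-- The von Neumann algebra generated by a set `S` of bounded operators, i.e. the double commutant
of `S ∪ S*`. -/
def generated {H : Type*} [NormedAddCommGroup H] [InnerProductSpace ℂ H] [CompleteSpace H]
    (S : Set (H →L[ℂ] H)) : VonNeumannAlgebra H where
  toStarSubalgebra :=
    StarSubalgebra.centralizer ℂ (StarSubalgebra.centralizer ℂ S : Set (H →L[ℂ] H))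
  centralizer_centralizer' := by
    change Set.centralizer (Set.centralizer
      ((StarSubalgebra.centralizer ℂ (StarSubalgebra.centralizer ℂ S : Set (H →L[ℂ] H)) :
        StarSubalgebra ℂ (H →L[ℂ] H)) : Set (H →L[ℂ] H))) = _
    rw [StarSubalgebra.coe_centralizer ℂ (StarSubalgebra.centralizer ℂ S : Set (H →L[ℂ] H)),
      Set.centralizer_centralizer_centralizer]
    exact (StarSubalgebra.coe_centralizer ℂ _).symm

/-- The Hilbert space `ℓ²(Γ)`. -/
abbrev ell2 (Γ : Type u) : Type u := lp (fun _ : Γ => ℂ) 2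

variable {Γ : Type u} [Group Γ]

/-- Left translation `(u_g ξ)(h) = ξ(g⁻¹ h)` on `ℓ²(Γ)`, as a linear isometry. -/
def translation (g : Γ) : ell2 Γ →ₗᵢ[ℂ] ell2 Γ where
  toFun ξ := ⟨fun h => ξ (g⁻¹ * h), by
    refine memℓp_gen ?_
    exact ((lp.memℓp ξ).summable (by norm_num)).comp_injective (mul_right_injective g⁻¹)⟩
  map_add' ξ η := rfl
  map_smul' c ξ := rfl
  norm_map' ξ := by
    have h2 : 0 < (2 : ℝ≥0∞).toReal := by norm_num
    rw [lp.norm_eq_tsum_rpow h2, lp.norm_eq_tsum_rpow h2]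
    congr 1
    exact (Equiv.mulLeft g⁻¹).tsum_eq (fun h => ‖ξ h‖ ^ (2 : ℝ≥0∞).toReal)

/-- The canonical unitary `u_g` of the left regular representation. -/
def u (g : Γ) : ell2 Γ →L[ℂ] ell2 Γ := (translation g).toContinuousLinearMap

variable (Γ) in
/-- The group von Neumann algebra `L(Γ)`, generated by the left regular representation. -/
def L : VonNeumannAlgebra (ell2 Γ) := generated (Set.range (u (Γ := Γ)))

open scoped Classical in
/-- The unit vector `δ_1 ∈ ℓ²(Γ)`. -/
def vacuum : ell2 Γ := lp.single 2 (1 : Γ) (1 : ℂ)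

/-- The canonical trace `τ(x) = ⟨x δ_1, δ_1⟩` (used only for `x ∈ L(Γ)`). -/
def τ (x : ell2 Γ →L[ℂ] ell2 Γ) : ℂ := inner ℂ (vacuum : ell2 Γ) (x vacuum)

/-- The norm `‖x‖₂ = τ(x* x)^{1/2}` (used only for `x ∈ L(Γ)`). -/
def norm2 (x : ell2 Γ →L[ℂ] ell2 Γ) : ℝ := √(τ (star x * x)).re

variable (Γ) in
/-- Fullness of `M = L(Γ)`: every bounded net in `M` that asymptotically commutes in `‖·‖₂` with
each element of `M` is asymptotically scalar. Index sets of nets range over the universe of `Γ`,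
which contains all the index sets `Finset M × ℕ` that are needed to describe the topology. -/
def IsFull : Prop :=
  ∀ (ι : Type u) [Preorder ι] [IsDirectedOrder ι] [Nonempty ι] (x : ι → ell2 Γ →L[ℂ] ell2 Γ),
    (∀ i, x i ∈ L Γ) → (∃ C : ℝ, ∀ i, ‖x i‖ ≤ C) →
    (∀ a ∈ L Γ, Filter.Tendsto (fun i => norm2 (x i * a - a * x i)) Filter.atTop (𝓝 0)) →
    Filter.Tendsto (fun i => norm2 (x i - τ (x i) • 1)) Filter.atTop (𝓝 0)

variable (Γ) in
/-- `Γ` is i.c.c.: it is infinite and every nontrivial conjugacy class is infinite. -/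
def IsICC : Prop := Infinite Γ ∧ ∀ g : Γ, g ≠ 1 → (conjugatesOf g).Infinite

/-- The bounded function `h ↦ f(g⁻¹ h g)`. -/
def conjFun (g : Γ) (f : lp (fun _ : Γ => ℝ) ∞) : lp (fun _ : Γ => ℝ) ∞ :=
  ⟨fun h => f (g⁻¹ * h * g), by
    refine memℓp_infty ?_
    obtain ⟨C, hC⟩ := memℓp_infty_iff.1 (lp.memℓp f)
    exact ⟨C, by rintro _ ⟨h, rfl⟩; exact hC ⟨g⁻¹ * h * g, rfl⟩⟩⟩

open scoped Classical in
variable (Γ) in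
/-- `Γ` is inner amenable: there is a conjugation-invariant mean `m` on `ℓ^∞(Γ)` that is
concentrated on `Γ \ {1}`. -/
def IsInnerAmenable : Prop :=
  ∃ m : lp (fun _ : Γ => ℝ) ∞ →ₗ[ℝ] ℝ,
    (∀ f, (∀ h, 0 ≤ f h) → 0 ≤ m f) ∧ m 1 = 1 ∧ m (lp.single ∞ (1 : Γ) (1 : ℝ)) = 0 ∧
    ∀ (g : Γ) (f : lp (fun _ : Γ => ℝ) ∞), m (conjFun g f) = m f

/-- The gap inequality on the corner `p L(Γ) p` for the finite set `K` and the constant `κ`. -/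
def HasLocalGap (p : ell2 Γ →L[ℂ] ell2 Γ) (K : Finset Γ) (κ : ℝ) : Prop :=
  ∀ x ∈ L Γ, p * x * p = x → τ x = 0 →
    norm2 x ≤ κ * ∑ g ∈ K, norm2 (p * (x * u g - u g * x) * p)

end

end GroupFactor

namespace GroupFactor

/-! ### Basis vectors, right translations, and the trace and 2-norm on `L Γ`. -/

section Basics

variable {Γ : Type u}

/-! Fullness is used by contradiction. If the gap fails on the corner of `p`, there is a
self-adjoint traceless `x` in the corner almost commuting with the `u g`. Approximate `x` by a
combination of orthogonal projections `f i` with sum `p`. The vertex weights `τ (f i)` and edge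
weights `∑ g ∈ K, norm2 (f i * u g * f j) ^ 2` form a finite graph in which squared compressed
commutators become Dirichlet energy. Centering at a median and running Cheeger's argument gives `r ≤
p` with at most half the trace of `p` and boundary at most `c * τ r`
(`exists_projection_of_no_gap`).

Such an `r` may be tiny, but the bound is proportional to its trace, so pieces can be accumulated.
In a maximal accumulation, trace below `ε ^ 2` would leave `1 - r` so close to `1` that another
piece could be cut from it (`exists_projection_of_no_local_gap`). Growing `K` and shrinking `c` give
an asymptotically central net of projections with traces bounded away from 0 and 1, contradicting
fullness.

For `p = 1`, the map `x ↦ x δ_1` turns commutators with `u g` into displacements under conjugation.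
Failure of all gaps gives almost invariant unit vectors orthogonal to `δ_1`, whose squared moduli
converge along an ultrafilter to an invariant mean. Conversely, Hahn–Banach separation turns a mean
into almost invariant finitely supported measures, whose square roots violate any gap. -/

theorem norm_le_one_of_isStarProjection {H : Type*} [NormedAddCommGroup H]
    [InnerProductSpace ℂ H] [CompleteSpace H] {p : H →L[ℂ] H} (hp : IsStarProjection p) :
    ‖p‖ ≤ 1 := by
  obtain ⟨K, _, rfl⟩ := isStarProjection_iff_eq_starProjection.1 hp
  exact K.starProjection_norm_le

open scoped Classical in
/-- The orthonormal basis vector `δ_g`. -/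
noncomputable def basisVec (g : Γ) : ell2 Γ := lp.single 2 g (1 : ℂ)

theorem basisVec_apply_self (g : Γ) : basisVec g g = 1 := by
  classical
  simp [basisVec]

theorem basisVec_apply_ne {g h : Γ} (hne : h ≠ g) : basisVec g h = 0 := by
  classical
  simp [basisVec, hne]

open scoped Classical in
theorem smul_basisVec (c : ℂ) (g : Γ) : c • basisVec g = lp.single 2 g c := by
  rw [basisVec, ← lp.single_smul, smul_eq_mul, mul_one]

theorem inner_basisVec_left (g : Γ) (ξ : ell2 Γ) : inner ℂ (basisVec g) ξ = ξ g := by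
  classical
  rw [basisVec, lp.inner_single_left]
  simp

variable [Group Γ]

theorem vacuum_eq_basisVec : (vacuum : ell2 Γ) = basisVec 1 := rfl

theorem norm_vacuum : ‖(vacuum : ell2 Γ)‖ = 1 := by
  classical
  rw [vacuum, lp.norm_single (by norm_num)]
  simp

@[simp]
theorem u_apply (g : Γ) (ξ : ell2 Γ) (h : Γ) : u g ξ h = ξ (g⁻¹ * h) := rfl

@[simp]
theorem norm_u_apply (g : Γ) (ξ : ell2 Γ) : ‖u g ξ‖ = ‖ξ‖ := (translation g).norm_map ξ

theorem u_basisVec (g h : Γ) : u g (basisVec h) = basisVec (g * h) := by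
  ext k
  rw [u_apply]
  by_cases hk : k = g * h
  · subst hk
    simp [basisVec_apply_self]
  · rw [basisVec_apply_ne hk, basisVec_apply_ne]
    rintro rfl
    simp at hk

theorem u_vacuum (g : Γ) : u g (vacuum : ell2 Γ) = basisVec g := by
  rw [vacuum_eq_basisVec, u_basisVec, mul_one]

theorem u_mul (g h : Γ) : (u (g * h) : ell2 Γ →L[ℂ] ell2 Γ) = u g * u h := by
  ext ξ k
  simp [mul_assoc]

theorem u_one : (u (1 : Γ) : ell2 Γ →L[ℂ] ell2 Γ) = 1 := by
  ext ξ k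
  simp

theorem star_u (g : Γ) : star (u g : ell2 Γ →L[ℂ] ell2 Γ) = u g⁻¹ := by
  rw [ContinuousLinearMap.star_eq_adjoint]
  symm
  rw [ContinuousLinearMap.eq_adjoint_iff]
  intro ξ η
  have h := (translation g).inner_map_map (u g⁻¹ ξ) η
  have h1 : translation g (u g⁻¹ ξ) = ξ := by
    change (u g * u g⁻¹) ξ = ξ
    rw [← u_mul, mul_inv_cancel, u_one, one_apply_eq_self]
  rw [h1] at h
  exact h.symm

theorem norm_u_le (g : Γ) : ‖(u g : ell2 Γ →L[ℂ] ell2 Γ)‖ ≤ 1 :=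
  ContinuousLinearMap.opNorm_le_bound _ zero_le_one fun ξ => by simp

/-- Right translation `(ρ_g ξ)(h) = ξ(h g)` on `ℓ²(Γ)`. -/
noncomputable def rightTranslation (g : Γ) : ell2 Γ →ₗᵢ[ℂ] ell2 Γ where
  toFun ξ := ⟨fun h => ξ (h * g), by
    refine memℓp_gen ?_
    exact ((lp.memℓp ξ).summable (by norm_num)).comp_injective (mul_left_injective g)⟩
  map_add' ξ η := rfl
  map_smul' c ξ := rfl
  norm_map' ξ := by
    have h2 : 0 < (2 : ℝ≥0∞).toReal := by norm_num
    rw [lp.norm_eq_tsum_rpow h2, lp.norm_eq_tsum_rpow h2]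
    congr 1
    exact (Equiv.mulRight g).tsum_eq (fun h => ‖ξ h‖ ^ (2 : ℝ≥0∞).toReal)

@[simp]
theorem rightTranslation_apply (g : Γ) (ξ : ell2 Γ) (h : Γ) :
    rightTranslation g ξ h = ξ (h * g) := rfl

theorem rightTranslation_basisVec (g h : Γ) :
    rightTranslation g (basisVec h) = basisVec (h * g⁻¹) := by
  ext k
  rw [rightTranslation_apply]
  by_cases hk : k = h * g⁻¹
  · subst hk
    simp [basisVec_apply_self]
  · rw [basisVec_apply_ne hk, basisVec_apply_ne]
    rintro rfl
    simp at hk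

/-- An operator lies in `L(Γ)` as soon as it commutes with everything commuting with all `u_g`. -/
theorem mem_L_iff {x : ell2 Γ →L[ℂ] ell2 Γ} :
    x ∈ L Γ ↔ ∀ b : ell2 Γ →L[ℂ] ell2 Γ, (∀ g : Γ, Commute b (u g)) → Commute b x := by
  have hc : ∀ b : ell2 Γ →L[ℂ] ell2 Γ,
      b ∈ StarSubalgebra.centralizer ℂ (Set.range (u (Γ := Γ))) ↔ ∀ g : Γ, Commute b (u g) := by
    intro b
    rw [StarSubalgebra.mem_centralizer_iff]
    constructor
    · intro h g
      exact (h _ ⟨g, rfl⟩).1.symm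
    · rintro h _ ⟨g, rfl⟩
      refine ⟨(h g).eq.symm, ?_⟩
      rw [star_u]
      exact (h g⁻¹).eq.symm
  change x ∈ StarSubalgebra.centralizer ℂ
    (StarSubalgebra.centralizer ℂ (Set.range (u (Γ := Γ))) : Set (ell2 Γ →L[ℂ] ell2 Γ)) ↔ _
  rw [StarSubalgebra.mem_centralizer_iff]
  constructor
  · intro h b hb
    exact (h b ((hc b).2 hb)).1
  · intro h b hb
    exact ⟨h b ((hc b).1 hb), h _ ((hc _).1 (star_mem hb))⟩

theorem u_mem (g : Γ) : u g ∈ L Γ := mem_L_iff.2 fun _ hb => hb g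

theorem smul_mem_L {x : ell2 Γ →L[ℂ] ell2 Γ} (c : ℂ) (hx : x ∈ L Γ) : c • x ∈ L Γ :=
  (L Γ).toStarSubalgebra.smul_mem hx c

theorem mem_L_of_commute {x y : ell2 Γ →L[ℂ] ell2 Γ} (hx : x ∈ L Γ)
    (h : ∀ b, Commute b x → Commute b y) : y ∈ L Γ :=
  mem_L_iff.2 fun b hb => h b (mem_L_iff.1 hx b hb)

theorem commute_rightTranslation {x : ell2 Γ →L[ℂ] ell2 Γ} (hx : x ∈ L Γ) (g : Γ)
    (ξ : ell2 Γ) : x (rightTranslation g ξ) = rightTranslation g (x ξ) := by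
  have h := mem_L_iff.1 hx (rightTranslation g).toContinuousLinearMap (by
    intro k
    ext ξ h
    simp [mul_assoc])
  exact (congrArg (fun T : ell2 Γ →L[ℂ] ell2 Γ => T ξ) h.eq).symm

/-- `δ_g` is a right translate of `δ_1` and right translations commute with `L Γ`, so `x` is
determined by its coefficients `x vacuum`. -/
theorem apply_basisVec {x : ell2 Γ →L[ℂ] ell2 Γ} (hx : x ∈ L Γ) (g : Γ) :
    x (basisVec g) = rightTranslation g⁻¹ (x vacuum) := by
  rw [← commute_rightTranslation hx, vacuum_eq_basisVec, rightTranslation_basisVec]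
  simp

theorem star_apply_vacuum {x : ell2 Γ →L[ℂ] ell2 Γ} (hx : x ∈ L Γ) (g : Γ) :
    (star x) vacuum g = star (x vacuum g⁻¹) := by
  rw [← inner_basisVec_left, ContinuousLinearMap.star_eq_adjoint,
    ContinuousLinearMap.adjoint_inner_right, apply_basisVec hx, ← inner_conj_symm,
    vacuum_eq_basisVec, inner_basisVec_left]
  simp

theorem τ_eq_inner (x : ell2 Γ →L[ℂ] ell2 Γ) : τ x = x vacuum 1 := by
  rw [τ, vacuum_eq_basisVec, inner_basisVec_left]

theorem τ_star (x : ell2 Γ →L[ℂ] ell2 Γ) : τ (star x) = star (τ x) := by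
  rw [τ, τ, ContinuousLinearMap.star_eq_adjoint, ContinuousLinearMap.adjoint_inner_right,
    ← inner_conj_symm]
  rfl

/-- `τ` is a trace on `L(Γ)`. -/
theorem τ_mul_comm {x y : ell2 Γ →L[ℂ] ell2 Γ} (hx : x ∈ L Γ) (hy : y ∈ L Γ) :
    τ (x * y) = τ (y * x) := by
  -- The sum below is symmetric in `x` and `y` after `g ↦ g⁻¹`.
  have key : ∀ {x y : ell2 Γ →L[ℂ] ell2 Γ}, x ∈ L Γ →
      τ (x * y) = ∑' g, x vacuum g⁻¹ * y vacuum g := by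
    intro x y hx
    rw [τ, mul_apply_eq_comp, ← ContinuousLinearMap.adjoint_inner_left,
      lp.inner_eq_tsum]
    refine tsum_congr fun g => ?_
    rw [← ContinuousLinearMap.star_eq_adjoint, star_apply_vacuum hx]
    simp [mul_comm]
  rw [key hx, key hy, ← (Equiv.inv Γ).tsum_eq]
  refine tsum_congr fun g => ?_
  simp [mul_comm]

@[simp] theorem τ_zero : τ (0 : ell2 Γ →L[ℂ] ell2 Γ) = 0 := by simp [τ]

theorem τ_add (x y : ell2 Γ →L[ℂ] ell2 Γ) : τ (x + y) = τ x + τ y := by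
  simp [τ]

theorem τ_sub (x y : ell2 Γ →L[ℂ] ell2 Γ) : τ (x - y) = τ x - τ y := by
  simp [τ]

theorem τ_smul (c : ℂ) (x : ell2 Γ →L[ℂ] ell2 Γ) : τ (c • x) = c * τ x := by
  simp [τ]

theorem τ_one : τ (1 : ell2 Γ →L[ℂ] ell2 Γ) = 1 := by
  simp [τ, inner_self_eq_norm_sq_to_K, norm_vacuum]

theorem τ_star_mul_self (x : ell2 Γ →L[ℂ] ell2 Γ) :
    τ (star x * x) = ((‖x vacuum‖ ^ 2 : ℝ) : ℂ) := by
  rw [τ, mul_apply_eq_comp, ContinuousLinearMap.star_eq_adjoint,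
    ContinuousLinearMap.adjoint_inner_right, inner_self_eq_norm_sq_to_K]
  simp

theorem norm2_eq (x : ell2 Γ →L[ℂ] ell2 Γ) : norm2 x = ‖x vacuum‖ := by
  rw [norm2, τ_star_mul_self, Complex.ofReal_re, Real.sqrt_sq (norm_nonneg _)]

theorem norm2_nonneg (x : ell2 Γ →L[ℂ] ell2 Γ) : 0 ≤ norm2 x := Real.sqrt_nonneg _

theorem norm2_sq (x : ell2 Γ →L[ℂ] ell2 Γ) : norm2 x ^ 2 = (τ (star x * x)).re := by
  rw [norm2_eq, τ_star_mul_self, Complex.ofReal_re]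

theorem norm2_star {x : ell2 Γ →L[ℂ] ell2 Γ} (hx : x ∈ L Γ) : norm2 (star x) = norm2 x := by
  rw [norm2, norm2, star_star, τ_mul_comm hx (star_mem hx)]

theorem norm2_add_le (x y : ell2 Γ →L[ℂ] ell2 Γ) : norm2 (x + y) ≤ norm2 x + norm2 y := by
  simp only [norm2_eq]
  exact norm_add_le _ _

theorem norm2_sub_le (x y : ell2 Γ →L[ℂ] ell2 Γ) : norm2 (x - y) ≤ norm2 x + norm2 y := by
  simp only [norm2_eq]
  exact norm_sub_le _ _

theorem norm2_smul (c : ℂ) (x : ell2 Γ →L[ℂ] ell2 Γ) : norm2 (c • x) = ‖c‖ * norm2 x := by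
  simp only [norm2_eq]
  exact norm_smul c (x vacuum)

theorem norm2_neg (x : ell2 Γ →L[ℂ] ell2 Γ) : norm2 (-x) = norm2 x := by
  simp only [norm2_eq]
  exact norm_neg (x vacuum)

theorem norm2_le_norm (x : ell2 Γ →L[ℂ] ell2 Γ) : norm2 x ≤ ‖x‖ := by
  rw [norm2_eq]
  simpa [norm_vacuum] using x.le_opNorm vacuum

theorem norm2_mul_le_left (a x : ell2 Γ →L[ℂ] ell2 Γ) : norm2 (a * x) ≤ ‖a‖ * norm2 x := by
  simp only [norm2_eq]
  exact a.le_opNorm _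

/-- The trace property makes the adjoint isometric for `norm2`, which reduces this to left
multiplication. -/
theorem norm2_mul_le_right {x b : ell2 Γ →L[ℂ] ell2 Γ} (hx : x ∈ L Γ) (hb : b ∈ L Γ) :
    norm2 (x * b) ≤ norm2 x * ‖b‖ := by
  rw [← norm2_star (mul_mem hx hb), star_mul, ← norm2_star hx, mul_comm (norm2 _), ← norm_star b]
  exact norm2_mul_le_left _ _

theorem norm2_sq_of_isStarProjection {p : ell2 Γ →L[ℂ] ell2 Γ} (hp : IsStarProjection p) :
    norm2 p ^ 2 = (τ p).re := by
  rw [norm2_sq, hp.isSelfAdjoint.star_eq, hp.isIdempotentElem.eq]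

end Basics

/-! ### Approximation of self-adjoint operators by finite spectrum. -/

section Spectral

variable {H : Type*} [NormedAddCommGroup H] [InnerProductSpace ℂ H] [CompleteSpace H]

/-- An operator commuting with a self-adjoint `a` commutes with the projection onto the closure of the
range of `a`. -/
theorem commute_starProjection_closure_range {a b : H →L[ℂ] H} (ha : IsSelfAdjoint a)
    (hb : Commute b a) : Commute b a.range.topologicalClosure.starProjection := by
  set P := a.range.topologicalClosure.starProjection with hP
  -- Operators commuting with `a` preserve its closed range. Applied to `b` and `star b`, this makes
  -- the range reducing for `b`.
  have key : ∀ c : H →L[ℂ] H, Commute c a → P * c * P = c * P := by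
    intro c hc
    ext ξ
    refine Submodule.starProjection_eq_self_iff.2 ?_
    have h1 : P ξ ∈ a.range.topologicalClosure := Submodule.starProjection_apply_mem _ _
    have h2 : Set.MapsTo c (closure (a.range : Set H)) (closure (a.range : Set H)) := by
      refine Set.MapsTo.closure ?_ c.continuous
      rintro _ ⟨η, rfl⟩
      exact ⟨c η, congrArg (fun T : H →L[ℂ] H => T η) hc.eq.symm⟩
    exact h2 h1
  have hPs : star P = P := isStarProjection_starProjection.isSelfAdjoint.star_eq
  have h1 := key b hb
  have h2 := key (star b) (by
    have := hb.star_star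
    rwa [ha.star_eq] at this)
  have h3 := congrArg star h2
  simp only [star_mul, star_star, hPs] at h3
  change b * P = P * b
  rw [← h3, ← mul_assoc, h1]

/-- Polar decomposition of a self-adjoint operator: there is a projection `f`, commuting with
everything that commutes with `r`, such that `(2 f - 1) r = |r|`. -/
theorem exists_isStarProjection_mul_eq_abs {r : H →L[ℂ] H} (hr : IsSelfAdjoint r) :
    ∃ f : H →L[ℂ] H, IsStarProjection f ∧ (∀ b, Commute b r → Commute b f) ∧
      (2 * f - 1) * r = CFC.abs r := by
  have hpos : IsSelfAdjoint (r⁺) := (CFC.posPart_nonneg r).isSelfAdjoint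
  have hneg : IsSelfAdjoint (r⁻) := (CFC.negPart_nonneg r).isSelfAdjoint
  -- The support projection of `r⁺` fixes `r⁺` and kills `r⁻`, so `2 * f - 1` sends `r⁺ - r⁻` to `r⁺
  -- + r⁻`.
  set f := (r⁺).range.topologicalClosure.starProjection with hf
  have hfs : star f = f := isStarProjection_starProjection.isSelfAdjoint.star_eq
  have h1 : f * r⁺ = r⁺ := by
    ext ξ
    exact Submodule.starProjection_eq_self_iff.2
      (Submodule.le_topologicalClosure _ ⟨ξ, rfl⟩)
  have h2 : r⁻ * f = 0 := by
    ext ξ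
    have hm : f ξ ∈ (r⁺).range.topologicalClosure := Submodule.starProjection_apply_mem _ _
    have hle : (r⁺).range.topologicalClosure ≤ (r⁻).ker := by
      refine Submodule.topologicalClosure_minimal _ ?_ (r⁻).isClosed_ker
      rintro _ ⟨η, rfl⟩
      exact congrArg (fun T : H →L[ℂ] H => T η) (CFC.negPart_mul_posPart r)
    exact hle hm
  have h3 : f * r⁻ = 0 := by
    have := congrArg star h2
    simpa [hfs, hneg.star_eq] using this
  refine ⟨f, isStarProjection_starProjection, fun b hb => ?_, ?_⟩
  · refine commute_starProjection_closure_range hpos ?_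
    exact (hb.symm.cfcₙ_real _).symm
  · have e1 := CFC.posPart_sub_negPart r hr
    have e2 := CFC.posPart_add_negPart r hr
    have e3 : f * r = r⁺ := by
      conv_lhs => rw [← e1]
      rw [mul_sub, h1, h3, sub_zero]
    rw [sub_mul, one_mul, mul_assoc, e3, ← e2, two_mul, sub_eq_iff_eq_add, add_assoc,
      add_right_inj]
    exact sub_eq_iff_eq_add'.1 e1

/-- The spectrum of `|r|` lies in `[0, 2c]`; recentering at the midpoint halves the bound. -/
theorem norm_abs_sub_half_le {r : H →L[ℂ] H} (hr : IsSelfAdjoint r) {c : ℝ} (hc : ‖r‖ ≤ 2 * c) :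
    ‖CFC.abs r - (c : ℂ) • 1‖ ≤ c := by
  have hc0 : 0 ≤ c := by linarith [norm_nonneg r]
  have e : CFC.abs r - (c : ℂ) • 1 = cfc (fun t : ℝ => ‖t‖ - c) r := by
    rw [cfc_sub (fun t : ℝ => ‖t‖) (fun _ => c) r, cfc_const c r, ← CFC.abs_eq_cfc_norm r,
      Algebra.algebraMap_eq_smul_one]
    rfl
  rw [e]
  refine norm_cfc_le hc0 fun t ht => ?_
  have h1 : ‖t‖ ≤ ‖r‖ := by
    refine (spectrum.norm_le_norm_mul_of_mem ht).trans ?_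
    exact mul_le_of_le_one_right (norm_nonneg r) ContinuousLinearMap.norm_id_le
  rw [Real.norm_eq_abs, abs_le]
  constructor <;> linarith [norm_nonneg t]

/-- A finite resolution of the identity by orthogonal projections that lie in the double commutant
of `x`. -/
structure IsResolution {ι : Type*} [Fintype ι] (x : H →L[ℂ] H) (e : ι → H →L[ℂ] H) : Prop where
  isStarProjection : ∀ i, IsStarProjection (e i)
  mul_eq_zero : ∀ i j, i ≠ j → e i * e j = 0
  sum_eq : ∑ i, e i = 1
  commute : ∀ i b, Commute b x → Commute b (e i)

/-- Bisection: split each projection by the sign projection `f` of the remainder and shift its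
coefficient by `±c`. The new remainder is `(2 * f - 1) * (|x - y| - c)`, with half the old bound.
All projections stay in the double commutant of `x`, hence in `L Γ` when `x` is. -/
theorem exists_resolution {x : H →L[ℂ] H} (hx : IsSelfAdjoint x) (n : ℕ) :
    ∃ (ι : Type) (_ : Fintype ι) (e : ι → H →L[ℂ] H) (a : ι → ℝ),
      IsResolution x e ∧ ‖x - ∑ i, (a i : ℂ) • e i‖ ≤ ‖x‖ / 2 ^ n := by
  induction n with
  | zero =>
    refine ⟨Unit, inferInstance, fun _ => 1, fun _ => 0, ⟨fun _ => .one _, ?_, by simp,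
      fun _ b _ => Commute.one_right b⟩, by simp⟩
    intro i j hij
    exact absurd rfl hij
  | succ n ih =>
    obtain ⟨ι, _, e, a, he, hn⟩ := ih
    set y := ∑ i, (a i : ℂ) • e i with hy
    have hys : IsSelfAdjoint y := by
      refine isSelfAdjoint_sum _ fun i _ => ?_
      exact IsSelfAdjoint.smul (by simp [IsSelfAdjoint]) (he.isStarProjection i).isSelfAdjoint
    have hr : IsSelfAdjoint (x - y) := hx.sub hys
    obtain ⟨f, hf, hfc, habs⟩ := exists_isStarProjection_mul_eq_abs hr
    have hcy : ∀ b, Commute b x → Commute b (x - y) := fun b hb =>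
      hb.sub_right (Commute.sum_right _ _ _ fun i _ => (he.commute i b hb).smul_right _)
    have hef : ∀ i, Commute (e i) f := fun i =>
      hfc _ (hcy _ (he.commute i x (Commute.refl x)).symm)
    set c : ℝ := ‖x‖ / 2 ^ (n + 1) with hc
    have hf1 := hf.one_sub
    have hef1 : ∀ i, Commute (e i) (1 - f) := fun i => (Commute.one_right _).sub_right (hef i)
    refine ⟨ι × Bool, inferInstance, fun k => e k.1 * bif k.2 then f else 1 - f,
      fun k => a k.1 + bif k.2 then c else -c, ⟨?_, ?_, ?_, ?_⟩, ?_⟩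
    · rintro ⟨i, _ | _⟩
      · exact (he.isStarProjection i).mul hf1 (hef1 i)
      · exact (he.isStarProjection i).mul hf (hef i)
    · rintro ⟨i, s⟩ ⟨j, t⟩ hne
      by_cases hij : i = j
      · subst hij
        rcases s with _ | _ <;> rcases t with _ | _
        · exact absurd rfl hne
        · change e i * (1 - f) * (e i * f) = 0
          rw [(hef i).eq, mul_assoc, ← mul_assoc (1 - f), hf.one_sub_mul_self, zero_mul, mul_zero]
        · change e i * f * (e i * (1 - f)) = 0
          rw [(hef1 i).eq, mul_assoc, ← mul_assoc f, hf.mul_one_sub_self, zero_mul, mul_zero]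
        · exact absurd rfl hne
      · have hcomm : ∀ v w, Commute (e i) v → e i * v * (e j * w) = 0 := by
          intro v w hv
          rw [hv.eq, mul_assoc, ← mul_assoc (e i), he.mul_eq_zero i j hij, zero_mul, mul_zero]
        refine hcomm _ _ ?_
        cases s
        exacts [hef1 i, hef i]
    · simp [Fintype.sum_prod_type, ← mul_add, he.sum_eq]
    · rintro ⟨i, _ | _⟩ b hb
      · exact (he.commute i b hb).mul_right ((Commute.one_right b).sub_right (hfc b (hcy b hb)))
      · exact (he.commute i b hb).mul_right (hfc b (hcy b hb))
    · have hsum : ∑ k : ι × Bool, ((a k.1 + bif k.2 then c else -c : ℝ) : ℂ) •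
          (e k.1 * bif k.2 then f else 1 - f) = y + (c : ℂ) • (2 * f - 1) := by
        have h1 : ∀ i, ((a i + c : ℝ) : ℂ) • (e i * f) + ((a i + -c : ℝ) : ℂ) • (e i * (1 - f)) =
            (a i : ℂ) • e i + e i * ((c : ℂ) • (2 * f - 1)) := by
          intro i
          simp only [Complex.ofReal_add, Complex.ofReal_neg, mul_sub, mul_one, mul_smul_comm,
            two_mul, mul_add]
          module
        simp only [Fintype.sum_prod_type, Fintype.sum_bool, cond_true, cond_false, h1,
          Finset.sum_add_distrib, ← Finset.sum_mul, he.sum_eq, one_mul, hy]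
      rw [hsum]
      have hs2 : (2 * f - 1) * (2 * f - 1) = 1 := by
        have := hf.isIdempotentElem.eq
        simp only [two_mul, mul_sub, sub_mul, mul_add, add_mul, this, mul_one, one_mul]
        abel
      have e1 : x - (y + (c : ℂ) • (2 * f - 1)) = (2 * f - 1) * (CFC.abs (x - y) - (c : ℂ) • 1) := by
        rw [mul_sub, ← habs, ← mul_assoc, hs2, one_mul, mul_smul_comm, mul_one]
        abel
      have hsn : ‖2 * f - 1‖ ≤ 1 := by
        have hss : star (2 * f - 1) = 2 * f - 1 := by
          simp [two_mul, hf.isSelfAdjoint.star_eq]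
        have h1 : ‖2 * f - 1‖ * ‖2 * f - 1‖ = ‖(1 : H →L[ℂ] H)‖ := by
          rw [← CStarRing.norm_star_mul_self, hss, hs2]
        have h2 : ‖(1 : H →L[ℂ] H)‖ ≤ 1 := ContinuousLinearMap.norm_id_le
        nlinarith [norm_nonneg (2 * f - 1)]
      rw [e1]
      calc _ ≤ ‖2 * f - 1‖ * ‖CFC.abs (x - y) - (c : ℂ) • 1‖ := norm_mul_le _ _
        _ ≤ 1 * c := by
          refine mul_le_mul hsn (norm_abs_sub_half_le hr (hn.trans_eq ?_)) (norm_nonneg _)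
            zero_le_one
          rw [hc, pow_succ]
          field_simp
        _ = c := one_mul c

end Spectral

/-! ### A Cheeger inequality and medians for finite weighted families. -/

section LayerCake

variable {ι : Type*} [Fintype ι]

open MeasureTheory in
/-- A layer cake argument: if at each positive level the weight crossing the level dominates the
mass above it, then the weighted total variation dominates the total mass. -/
theorem sum_mul_le_of_forall_level {φ w : ι → ℝ} {μ : ι → ι → ℝ} {c : ℝ} (hφ : ∀ i, 0 ≤ φ i)
    (h : ∀ s, 0 < s → c * ∑ j, (if s ≤ φ j then w j else 0) ≤
      ∑ i, ∑ j, (if φ i < s ∧ s ≤ φ j then μ i j else 0)) :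
    c * ∑ j, w j * φ j ≤ ∑ i, ∑ j, μ i j * max (φ j - φ i) 0 := by
  have hint : ∀ a b m : ℝ, Integrable ((Set.Ioc a b).indicator fun _ : ℝ => m) := by
    intro a b m
    exact (integrable_indicator_iff measurableSet_Ioc).2 (integrableOn_const (by simp))
  have hval : ∀ a b m : ℝ, ∫ s, (Set.Ioc a b).indicator (fun _ : ℝ => m) s = m * max (b - a) 0 := by
    intro a b m
    rw [integral_indicator_const _ measurableSet_Ioc, Real.volume_real_Ioc, smul_eq_mul, mul_comm]
  -- Both sides are integrals over the level `s` of the two sides of `h`; levels `s ≤ 0` contribute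
  -- nothing.
  have hL : c * ∑ j, w j * φ j =
      ∫ s, c * ∑ j, (Set.Ioc 0 (φ j)).indicator (fun _ : ℝ => w j) s := by
    rw [integral_const_mul, integral_finsetSum _ fun j _ => hint _ _ _]
    simp [hval, hφ]
  have hR : ∑ i, ∑ j, μ i j * max (φ j - φ i) 0 =
      ∫ s, ∑ i, ∑ j, (Set.Ioc (φ i) (φ j)).indicator (fun _ : ℝ => μ i j) s := by
    rw [integral_finsetSum _ fun i _ => integrable_finsetSum _ fun j _ => hint _ _ _]
    refine Finset.sum_congr rfl fun i _ => ?_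
    rw [integral_finsetSum _ fun j _ => hint _ _ _]
    simp [hval]
  rw [hL, hR]
  refine integral_mono ((integrable_finsetSum _ fun j _ => hint _ _ _).const_mul c)
    (integrable_finsetSum _ fun i _ => integrable_finsetSum _ fun j _ => hint _ _ _) fun s => ?_
  rcases lt_or_ge 0 s with hs | hs
  · simpa [Set.indicator_apply, hs] using h s hs
  · have h1 : ∀ i, ¬ φ i < s := fun i => not_lt.2 (hs.trans (hφ i))
    simp [h1, not_lt.2 hs]

/-- A Cheeger-type inequality on a finite weighted graph: a function `a` with small Dirichlet energy
whose positive part carries half of its mass has a superlevel set with small boundary. -/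
theorem exists_level_set [DecidableEq ι] {a w : ι → ℝ} {μ : ι → ι → ℝ} {k D : ℝ} (hw : ∀ i, 0 ≤ w i)
    (hμ : ∀ i j, 0 ≤ μ i j) (hk : 1 ≤ k) (hD : 0 < D)
    (hrow : ∀ i, ∑ j, μ i j ≤ k * w i) (hcol : ∀ j, ∑ i, μ i j ≤ k * w j)
    (hpos : 0 < ∑ i, a i ^ 2 * w i)
    (hhalf : ∑ i, a i ^ 2 * w i ≤ 2 * ∑ i, (max (a i) 0) ^ 2 * w i)
    (hE : ∑ i, ∑ j, (a i - a j) ^ 2 * μ i j ≤ D ^ 2 * ∑ i, a i ^ 2 * w i) :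
    ∃ S : Finset ι, (∀ i ∈ S, 0 < a i) ∧ 0 < ∑ i ∈ S, w i ∧
      ∑ i ∈ Sᶜ, ∑ j ∈ S, μ i j ≤ 6 * k * D * ∑ i ∈ S, w i := by
  set N := ∑ i, a i ^ 2 * w i with hN
  set φ : ι → ℝ := fun i => (max (a i) 0) ^ 2 with hφ
  -- Superlevel sets of `φ` at positive levels lie in `{a > 0}`. If all of positive mass had large
  -- boundary, the layer cake bound would contradict the energy bound.
  by_contra! hcon
  have hlevel : ∀ s, 0 < s → (6 * k * D) * ∑ j, (if s ≤ φ j then w j else 0) ≤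
      ∑ i, ∑ j, (if φ i < s ∧ s ≤ φ j then μ i j else 0) := by
    intro s hs
    set S : Finset ι := Finset.univ.filter fun i => s ≤ φ i with hS
    have e1 : ∑ j, (if s ≤ φ j then w j else 0) = ∑ i ∈ S, w i := by
      rw [hS, Finset.sum_filter]
    have e2 : ∑ i, ∑ j, (if φ i < s ∧ s ≤ φ j then μ i j else 0) = ∑ i ∈ Sᶜ, ∑ j ∈ S, μ i j := by
      have : Sᶜ = Finset.univ.filter fun i => φ i < s := by
        ext i
        simp [hS]
      rw [this, Finset.sum_filter]
      refine Finset.sum_congr rfl fun i _ => ?_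
      rw [hS, Finset.sum_filter]
      split_ifs with h <;> simp [h]
    rw [e1, e2]
    rcases (Finset.sum_nonneg fun i (_ : i ∈ S) => hw i).lt_or_eq with h | h
    · refine (hcon S (fun i hi => ?_) h).le
      by_contra hi0
      have : φ i = 0 := by simp [hφ, max_eq_right (not_lt.1 hi0)]
      have := (Finset.mem_filter.1 hi).2
      linarith
    · rw [← h, mul_zero]
      exact Finset.sum_nonneg fun i _ => Finset.sum_nonneg fun j _ => hμ i j
  have h1 := sum_mul_le_of_forall_level (fun i => sq_nonneg _) hlevel
  have h2 : ∀ i j, μ i j * max (φ j - φ i) 0 ≤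
      (D * (a i ^ 2 + a j ^ 2) + D⁻¹ * (a i - a j) ^ 2 / 2) * μ i j := by
    intro i j
    rw [mul_comm]
    refine mul_le_mul_of_nonneg_right ?_ (hμ i j)
    have hDD : D * D⁻¹ = 1 := mul_inv_cancel₀ hD.ne'
    have hDi : 0 < D⁻¹ := inv_pos.2 hD
    have hφle : φ j - φ i ≤ |a i - a j| * (|a i| + |a j|) := by
      simp only [hφ]
      have hx : |max (a j) 0 - max (a i) 0| ≤ |a i - a j| := by
        rw [abs_sub_comm (a i)]
        exact abs_max_sub_max_le_abs _ _ _
      have hy1 : |max (a j) 0| ≤ |a j| := by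
        rw [abs_of_nonneg (le_max_right _ _)]
        exact max_le (le_abs_self _) (abs_nonneg _)
      have hy2 : |max (a i) 0| ≤ |a i| := by
        rw [abs_of_nonneg (le_max_right _ _)]
        exact max_le (le_abs_self _) (abs_nonneg _)
      calc _ = (max (a j) 0 - max (a i) 0) * (max (a j) 0 + max (a i) 0) := by ring
        _ ≤ |(max (a j) 0 - max (a i) 0) * (max (a j) 0 + max (a i) 0)| := le_abs_self _
        _ = |max (a j) 0 - max (a i) 0| * |max (a j) 0 + max (a i) 0| := abs_mul _ _
        _ ≤ |a i - a j| * (|a i| + |a j|) := by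
          refine mul_le_mul hx ?_ (abs_nonneg _) (abs_nonneg _)
          refine (abs_add_le _ _).trans ?_
          linarith
    refine max_le (hφle.trans ?_) (by positivity)
    have hsq : (|a i| + |a j|) ^ 2 ≤ 2 * (a i ^ 2 + a j ^ 2) := by
      have h1 := sq_abs (a i)
      have h2 := sq_abs (a j)
      nlinarith [sq_nonneg (|a i| - |a j|)]
    -- AM-GM weighted by `D`, which balances mass against energy of size `D ^ 2` times the mass.
    have hamgm : |a i - a j| * (|a i| + |a j|) ≤
        D * (|a i| + |a j|) ^ 2 / 2 + D⁻¹ * (a i - a j) ^ 2 / 2 := by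
      have h3 := sq_abs (a i - a j)
      have h4 : 0 ≤ D⁻¹ * (D * (|a i| + |a j|) - |a i - a j|) ^ 2 := by positivity
      have h5 : D⁻¹ * (D * (|a i| + |a j|) - |a i - a j|) ^ 2 =
          (D * D⁻¹) * D * (|a i| + |a j|) ^ 2 - 2 * (D * D⁻¹) * (|a i - a j| * (|a i| + |a j|)) +
            D⁻¹ * |a i - a j| ^ 2 := by ring
      rw [h5, hDD, h3] at h4
      linarith
    have := mul_le_mul_of_nonneg_left hsq hD.le
    linarith
  have h3 : ∑ i, ∑ j, μ i j * max (φ j - φ i) 0 ≤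
      D * (∑ i, a i ^ 2 * ∑ j, μ i j + ∑ j, a j ^ 2 * ∑ i, μ i j) +
        D⁻¹ / 2 * ∑ i, ∑ j, (a i - a j) ^ 2 * μ i j := by
    refine (Finset.sum_le_sum fun i _ => Finset.sum_le_sum fun j _ => h2 i j).trans_eq ?_
    have : ∑ j, a j ^ 2 * ∑ i, μ i j = ∑ i, ∑ j, a j ^ 2 * μ i j := by
      rw [Finset.sum_comm]
      simp only [Finset.mul_sum]
    rw [this]
    simp only [Finset.mul_sum, ← Finset.sum_add_distrib]
    refine Finset.sum_congr rfl fun i _ => Finset.sum_congr rfl fun j _ => ?_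
    ring
  have h4 : ∑ i, a i ^ 2 * ∑ j, μ i j ≤ k * N := by
    rw [hN, Finset.mul_sum]
    refine Finset.sum_le_sum fun i _ => ?_
    nlinarith [mul_le_mul_of_nonneg_left (hrow i) (sq_nonneg (a i))]
  have h5 : ∑ j, a j ^ 2 * ∑ i, μ i j ≤ k * N := by
    rw [hN, Finset.mul_sum]
    refine Finset.sum_le_sum fun i _ => ?_
    nlinarith [mul_le_mul_of_nonneg_left (hcol i) (sq_nonneg (a i))]
  have h6 : D⁻¹ / 2 * ∑ i, ∑ j, (a i - a j) ^ 2 * μ i j ≤ D / 2 * N := by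
    calc _ ≤ D⁻¹ / 2 * (D ^ 2 * N) := mul_le_mul_of_nonneg_left hE (by positivity)
      _ = D / 2 * N := by field_simp
  have h7 : ∑ j, w j * φ j = ∑ i, (max (a i) 0) ^ 2 * w i :=
    Finset.sum_congr rfl fun i _ => mul_comm _ _
  rw [h7] at h1
  -- The left side is `3kDN`, while the variation is at most `2kDN + DN/2 < 3kDN`.
  have h8 : 6 * k * D * (N / 2) ≤ 6 * k * D * ∑ i, (max (a i) 0) ^ 2 * w i :=
    mul_le_mul_of_nonneg_left (by linarith) (by positivity)
  have h9 := mul_le_mul_of_nonneg_left (add_le_add h4 h5) hD.le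
  have h10 : 0 < D * N := mul_pos hD hpos
  have h11 : D * N ≤ k * (D * N) := by nlinarith
  nlinarith

/-- Existence of a median for a finite weighted family of reals. -/
theorem exists_median {a w : ι → ℝ} (hw : ∀ i, 0 ≤ w i) :
    ∃ m : ℝ, (∀ S : Finset ι, (∀ i ∈ S, m < a i) → 2 * ∑ i ∈ S, w i ≤ ∑ i, w i) ∧
      (∀ S : Finset ι, (∀ i ∈ S, a i < m) → 2 * ∑ i ∈ S, w i ≤ ∑ i, w i) := by
  classical
  rcases isEmpty_or_nonempty ι with hι | hι
  · refine ⟨0, fun S _ => ?_, fun S _ => ?_⟩ <;> simp [Finset.eq_empty_of_isEmpty S]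
  -- The median is the least value with at most half the mass strictly above it. If `S` lies below
  -- it, more than half the mass lies strictly above `max S`, so `S` has less than half.
  set A : Finset ι := Finset.univ.filter fun j => 2 * ∑ i with a j < a i, w i ≤ ∑ i, w i with hA
  have hAne : A.Nonempty := by
    obtain ⟨j, _, hj⟩ := Finset.exists_max_image Finset.univ a Finset.univ_nonempty
    refine ⟨j, Finset.mem_filter.2 ⟨Finset.mem_univ _, ?_⟩⟩
    rw [Finset.filter_false_of_mem fun i hi => not_lt.2 (hj i hi)]
    simpa using Finset.sum_nonneg fun i _ => hw i
  obtain ⟨j, hjA, hj⟩ := Finset.exists_min_image A a hAne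
  refine ⟨a j, fun S hS => ?_, fun S hS => ?_⟩
  · refine le_trans ?_ (Finset.mem_filter.1 hjA).2
    refine mul_le_mul_of_nonneg_left ?_ zero_le_two
    exact Finset.sum_le_sum_of_subset_of_nonneg
      (fun i hi => Finset.mem_filter.2 ⟨Finset.mem_univ _, hS i hi⟩) fun i _ _ => hw i
  · rcases S.eq_empty_or_nonempty with rfl | hne
    · simpa using Finset.sum_nonneg fun i _ => hw i
    obtain ⟨l, hlS, hl⟩ := Finset.exists_max_image S a hne
    have hlA : l ∉ A := fun h => absurd (hj l h) (not_le.2 (hS l hlS))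
    have h1 : ∑ i, w i < 2 * ∑ i with a l < a i, w i := by
      by_contra h
      exact hlA (Finset.mem_filter.2 ⟨Finset.mem_univ _, not_lt.1 h⟩)
    have h2 : ∑ i ∈ S, w i + ∑ i with a l < a i, w i ≤ ∑ i, w i := by
      rw [← Finset.sum_union]
      · exact Finset.sum_le_sum_of_subset_of_nonneg (Finset.subset_univ _) fun i _ _ => hw i
      · rw [Finset.disjoint_left]
        intro i hi hi'
        exact absurd (hl i hi) (not_le.2 (Finset.mem_filter.1 hi').2)
    linarith

end LayerCake

/-! ### From almost commuting elements to projections with small boundary. -/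

section Cut

variable {Γ : Type u} {ι : Type*}

/-- In block form relative to the `f i`, the commutator multiplies the `(i, j)` block of `v` by `a i
- a j`: a discrete gradient. -/
theorem sum_smul_comm_eq [Fintype ι] {p v : ell2 Γ →L[ℂ] ell2 Γ}
    {f : ι → ell2 Γ →L[ℂ] ell2 Γ} (hf : ∀ i, IsStarProjection (f i))
    (ho : ∀ i j, i ≠ j → f i * f j = 0) (hsum : ∑ i, f i = p) (a : ι → ℝ) :
    p * ((∑ i, (a i : ℂ) • f i) * v - v * ∑ i, (a i : ℂ) • f i) * p =
      ∑ i, ∑ j, ((a i - a j : ℝ) : ℂ) • (f i * v * f j) := by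
  classical
  have h1 : ∀ j, p * f j = f j := fun j => by
    rw [← hsum, Finset.sum_mul, Finset.sum_eq_single j (fun i _ hij => ho i j hij) (by simp),
      (hf j).isIdempotentElem.eq]
  have h2 : ∀ j, f j * p = f j := fun j => by
    rw [← hsum, Finset.mul_sum, Finset.sum_eq_single j (fun i _ hij => ho j i hij.symm) (by simp),
      (hf j).isIdempotentElem.eq]
  have e1 : p * ((∑ i, (a i : ℂ) • f i) * v) * p = ∑ i, ∑ j, (a i : ℂ) • (f i * v * f j) := by
    rw [← mul_assoc, Finset.mul_sum]
    simp only [mul_smul_comm, h1]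
    rw [Finset.sum_mul, Finset.sum_mul]
    refine Finset.sum_congr rfl fun i _ => ?_
    rw [← hsum, Finset.mul_sum]
    simp only [smul_mul_assoc]
  have e2 : p * (v * ∑ i, (a i : ℂ) • f i) * p = ∑ i, ∑ j, (a j : ℂ) • (f i * v * f j) := by
    rw [← mul_assoc, mul_assoc, Finset.sum_mul]
    simp only [smul_mul_assoc, h2]
    rw [← hsum, Finset.sum_mul, Finset.sum_mul]
    refine Finset.sum_congr rfl fun i _ => ?_
    rw [Finset.mul_sum]
    simp only [mul_smul_comm]
  rw [mul_sub, sub_mul, e1, e2, ← Finset.sum_sub_distrib]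
  refine Finset.sum_congr rfl fun i _ => ?_
  rw [← Finset.sum_sub_distrib]
  refine Finset.sum_congr rfl fun j _ => ?_
  rw [← sub_smul, Complex.ofReal_sub]

theorem isStarProjection_sum {f : ι → ell2 Γ →L[ℂ] ell2 Γ} (hf : ∀ i, IsStarProjection (f i))
    (ho : ∀ i j, i ≠ j → f i * f j = 0) (s : Finset ι) : IsStarProjection (∑ i ∈ s, f i) := by
  classical
  induction s using Finset.induction_on with
  | empty => simp
  | insert i s hi ih =>
    rw [Finset.sum_insert hi]
    refine (hf i).add ih ?_
    rw [Finset.mul_sum]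
    refine Finset.sum_eq_zero fun j hj => ho i j ?_
    rintro rfl
    exact hi hj

variable [Group Γ]

/-- Pythagoras: the terms map `vacuum` into orthogonal ranges. -/
theorem norm2_sq_sum_left {f : ι → ell2 Γ →L[ℂ] ell2 Γ} (hf : ∀ i, IsStarProjection (f i))
    (ho : ∀ i j, i ≠ j → f i * f j = 0) (y : ι → ell2 Γ →L[ℂ] ell2 Γ) (s : Finset ι) :
    norm2 (∑ i ∈ s, f i * y i) ^ 2 = ∑ i ∈ s, norm2 (f i * y i) ^ 2 := by
  classical
  induction s using Finset.induction_on with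
  | empty => simp [norm2_eq]
  | insert i s hi ih =>
    rw [Finset.sum_insert hi, Finset.sum_insert hi, ← ih]
    simp only [norm2_eq]
    rw [add_apply, sq, sq, sq]
    refine norm_add_sq_eq_norm_sq_add_norm_sq_of_inner_eq_zero (𝕜 := ℂ) _ _ ?_
    rw [mul_apply_eq_comp, ← ContinuousLinearMap.adjoint_inner_right,
      ← ContinuousLinearMap.star_eq_adjoint, (hf i).isSelfAdjoint.star_eq, ← mul_apply_eq_comp,
      Finset.mul_sum, Finset.sum_eq_zero, zero_apply, inner_zero_right]
    intro j hj
    rw [← mul_assoc, ho i j (by rintro rfl; exact hi hj), zero_mul]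

theorem norm2_sq_sum_right {f : ι → ell2 Γ →L[ℂ] ell2 Γ} (hf : ∀ i, IsStarProjection (f i))
    (hL : ∀ i, f i ∈ L Γ) (ho : ∀ i j, i ≠ j → f i * f j = 0) {y : ι → ell2 Γ →L[ℂ] ell2 Γ}
    (hy : ∀ i, y i ∈ L Γ) (s : Finset ι) :
    norm2 (∑ i ∈ s, y i * f i) ^ 2 = ∑ i ∈ s, norm2 (y i * f i) ^ 2 := by
  have hm : ∀ i, y i * f i ∈ L Γ := fun i => mul_mem (hy i) (hL i)
  have hs : ∀ i, star (y i * f i) = f i * star (y i) := fun i => by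
    rw [star_mul, (hf i).isSelfAdjoint.star_eq]
  rw [← norm2_star (sum_mem fun i _ => hm i), star_sum]
  simp only [hs]
  rw [norm2_sq_sum_left hf ho]
  simp only [← hs, norm2_star (hm _)]

/-- Distinct blocks `f i * v * f j` are orthogonal for the trace, by Pythagoras on the left and then
on the right. -/
theorem norm2_sq_sum_sum {f : ι → ell2 Γ →L[ℂ] ell2 Γ} (hf : ∀ i, IsStarProjection (f i))
    (hL : ∀ i, f i ∈ L Γ) (ho : ∀ i j, i ≠ j → f i * f j = 0) {v : ell2 Γ →L[ℂ] ell2 Γ}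
    (hv : v ∈ L Γ) (c : ι → ι → ℝ) (s t : Finset ι) :
    norm2 (∑ i ∈ s, ∑ j ∈ t, (c i j : ℂ) • (f i * v * f j)) ^ 2 =
      ∑ i ∈ s, ∑ j ∈ t, c i j ^ 2 * norm2 (f i * v * f j) ^ 2 := by
  have e1 : ∀ i, ∑ j ∈ t, (c i j : ℂ) • (f i * v * f j) =
      f i * ∑ j ∈ t, (c i j : ℂ) • (v * f j) := fun i => by
    simp only [Finset.mul_sum, mul_smul_comm, mul_assoc]
  have e2 : ∀ i, ∑ j ∈ t, (c i j : ℂ) • (f i * v * f j) =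
      ∑ j ∈ t, ((c i j : ℂ) • (f i * v)) * f j := fun i => by
    simp only [smul_mul_assoc]
  simp only [e1]
  rw [norm2_sq_sum_left hf ho]
  refine Finset.sum_congr rfl fun i _ => ?_
  rw [← e1, e2, norm2_sq_sum_right hf hL ho fun j => smul_mem_L _ (mul_mem (hL i) hv)]
  refine Finset.sum_congr rfl fun j _ => ?_
  rw [smul_mul_assoc, norm2_smul, mul_pow]
  simp

/-- The sum of the `‖·‖₂`-norms of the commutators of `x` with `u_g`, `g ∈ K`, compressed by `p`. -/
noncomputable def commNorm (p : ell2 Γ →L[ℂ] ell2 Γ) (K : Finset Γ) (x : ell2 Γ →L[ℂ] ell2 Γ) :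
    ℝ :=
  ∑ g ∈ K, norm2 (p * (x * u g - u g * x) * p)

theorem commNorm_nonneg (p : ell2 Γ →L[ℂ] ell2 Γ) (K : Finset Γ) (x : ell2 Γ →L[ℂ] ell2 Γ) :
    0 ≤ commNorm p K x := Finset.sum_nonneg fun _ _ => norm2_nonneg _

theorem commNorm_add_le (p : ell2 Γ →L[ℂ] ell2 Γ) (K : Finset Γ) (x y : ell2 Γ →L[ℂ] ell2 Γ) :
    commNorm p K (x + y) ≤ commNorm p K x + commNorm p K y := by
  rw [commNorm, commNorm, commNorm, ← Finset.sum_add_distrib]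
  refine Finset.sum_le_sum fun g _ => ?_
  have : p * ((x + y) * u g - u g * (x + y)) * p =
      p * (x * u g - u g * x) * p + p * (y * u g - u g * y) * p := by noncomm_ring
  rw [this]
  exact norm2_add_le _ _

theorem commNorm_smul (p : ell2 Γ →L[ℂ] ell2 Γ) (K : Finset Γ) (c : ℂ)
    (x : ell2 Γ →L[ℂ] ell2 Γ) : commNorm p K (c • x) = ‖c‖ * commNorm p K x := by
  rw [commNorm, commNorm, Finset.mul_sum]
  refine Finset.sum_congr rfl fun g _ => ?_
  rw [← norm2_smul]
  simp only [smul_mul_assoc, mul_smul_comm, ← smul_sub]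

theorem commNorm_neg (p : ell2 Γ →L[ℂ] ell2 Γ) (K : Finset Γ) (x : ell2 Γ →L[ℂ] ell2 Γ) :
    commNorm p K (-x) = commNorm p K x := by
  have := commNorm_smul p K (-1) x
  simpa using this

/-- This allows centering at a median: adding a multiple of `p` leaves the compressed commutators
unchanged. -/
theorem commNorm_self {p : ell2 Γ →L[ℂ] ell2 Γ} (hp : IsStarProjection p) (K : Finset Γ) :
    commNorm p K p = 0 := by
  refine Finset.sum_eq_zero fun g _ => ?_
  have : p * (p * u g - u g * p) * p = 0 := by
    rw [mul_sub, sub_mul, ← mul_assoc, hp.isIdempotentElem.eq, mul_assoc p (u g * p),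
      mul_assoc (u g), hp.isIdempotentElem.eq, mul_assoc, sub_self]
  rw [this]
  simp [norm2_eq]

theorem commNorm_le_norm {p : ell2 Γ →L[ℂ] ell2 Γ} (hp : IsStarProjection p) (K : Finset Γ)
    (x : ell2 Γ →L[ℂ] ell2 Γ) : commNorm p K x ≤ K.card * (2 * ‖x‖) := by
  rw [← nsmul_eq_mul]
  refine Finset.sum_le_card_nsmul _ _ _ fun g _ => (norm2_le_norm _).trans ?_
  have h1 := norm_le_one_of_isStarProjection hp
  have h2 := norm_u_le g
  have h3 : ‖x * u g - u g * x‖ ≤ 2 * ‖x‖ := by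
    refine (norm_sub_le _ _).trans ?_
    have := norm_mul_le x (u g)
    have := norm_mul_le (u g) x
    have := mul_le_mul_of_nonneg_left h2 (norm_nonneg x)
    linarith
  calc _ ≤ ‖p‖ * ‖x * u g - u g * x‖ * ‖p‖ :=
        (norm_mul_le _ _).trans (mul_le_mul_of_nonneg_right (norm_mul_le _ _) (norm_nonneg _))
    _ ≤ 1 * ‖x * u g - u g * x‖ * 1 := by gcongr
    _ ≤ 2 * ‖x‖ := by simpa using h3

theorem commNorm_mono (p : ell2 Γ →L[ℂ] ell2 Γ) {K K' : Finset Γ} (h : K ⊆ K')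
    (x : ell2 Γ →L[ℂ] ell2 Γ) : commNorm p K x ≤ commNorm p K' x :=
  Finset.sum_le_sum_of_subset_of_nonneg h fun _ _ _ => norm2_nonneg _

/-- The adjoint exchanges the commutators with `u g` and `u g⁻¹` up to sign. -/
theorem commNorm_star {p : ell2 Γ →L[ℂ] ell2 Γ} (hp : IsStarProjection p) (hpL : p ∈ L Γ)
    {K : Finset Γ} (hK : ∀ g ∈ K, g⁻¹ ∈ K) {x : ell2 Γ →L[ℂ] ell2 Γ} (hx : x ∈ L Γ) :
    commNorm p K (star x) = commNorm p K x := by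
  refine Finset.sum_nbij' (fun g => g⁻¹) (fun g => g⁻¹) hK hK (by simp) (by simp) fun g _ => ?_
  have hm : p * (x * u g⁻¹ - u g⁻¹ * x) * p ∈ L Γ :=
    mul_mem (mul_mem hpL (sub_mem (mul_mem hx (u_mem _)) (mul_mem (u_mem _) hx))) hpL
  rw [← norm2_star hm, ← norm2_neg]
  congr 1
  simp only [star_mul, star_sub, star_u, inv_inv, hp.isSelfAdjoint.star_eq]
  noncomm_ring

theorem re_τ_sum (f : ι → ell2 Γ →L[ℂ] ell2 Γ) (s : Finset ι) :
    (τ (∑ i ∈ s, f i)).re = ∑ i ∈ s, (τ (f i)).re := by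
  classical
  induction s using Finset.induction_on with
  | empty => simp
  | insert i s hi ih => rw [Finset.sum_insert hi, Finset.sum_insert hi, τ_add, Complex.add_re, ih]

/-- A self-adjoint element of finite spectrum which almost commutes with `u_g`, `g ∈ K`, and whose
positive part is large but supported on at most half of `p`, has a spectral projection
with small boundary. -/
theorem exists_projection_of_finite_spectrum [Fintype ι] {p : ell2 Γ →L[ℂ] ell2 Γ}
    (hp : IsStarProjection p)
    {f : ι → ell2 Γ →L[ℂ] ell2 Γ} (hf : ∀ i, IsStarProjection (f i)) (hL : ∀ i, f i ∈ L Γ)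
    (ho : ∀ i j, i ≠ j → f i * f j = 0) (hsum : ∑ i, f i = p) {a : ι → ℝ} {K : Finset Γ} {D : ℝ}
    (hD : 0 < D) (hpos : 0 < norm2 (∑ i, (a i : ℂ) • f i))
    (hcomm : commNorm p K (∑ i, (a i : ℂ) • f i) ≤ D * norm2 (∑ i, (a i : ℂ) • f i))
    (hmed : ∀ S : Finset ι, (∀ i ∈ S, 0 < a i) → 2 * ∑ i ∈ S, (τ (f i)).re ≤ (τ p).re)
    (hhalf : ∑ i, a i ^ 2 * (τ (f i)).re ≤ 2 * ∑ i, (max (a i) 0) ^ 2 * (τ (f i)).re) :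
    ∃ r ∈ L Γ, IsStarProjection r ∧ p * r = r ∧ 0 < (τ r).re ∧ 2 * (τ r).re ≤ (τ p).re ∧
      ∀ g ∈ K, norm2 ((p - r) * u g * r) ^ 2 ≤ 6 * (K.card + 1) * D * (τ r).re := by
  classical
  have hpL : p ∈ L Γ := hsum ▸ sum_mem fun i _ => hL i
  set y := ∑ i, (a i : ℂ) • f i with hy
  have hw : ∀ i, (τ (f i)).re = norm2 (f i) ^ 2 := fun i => (norm2_sq_of_isStarProjection (hf i)).symm
  have hN : ∑ i, a i ^ 2 * (τ (f i)).re = norm2 y ^ 2 := by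
    have e : ∀ i, (a i : ℂ) • f i = f i * ((a i : ℂ) • 1) := fun i => by simp
    rw [hy]
    simp only [e]
    rw [norm2_sq_sum_left hf ho]
    refine Finset.sum_congr rfl fun i _ => ?_
    rw [← e, norm2_smul, hw, mul_pow]
    simp
  have hcut : ∀ (g : Γ) (s t : Finset ι), norm2 ((∑ i ∈ s, f i) * u g * ∑ j ∈ t, f j) ^ 2 =
      ∑ i ∈ s, ∑ j ∈ t, norm2 (f i * u g * f j) ^ 2 := by
    intro g s t
    have := norm2_sq_sum_sum hf hL ho (u_mem g) (fun _ _ => 1) s t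
    simp only [Complex.ofReal_one, one_smul, one_pow, one_mul] at this
    rw [← this, Finset.sum_mul, Finset.sum_mul]
    simp only [Finset.mul_sum]
  set μ : ι → ι → ℝ := fun i j => ∑ g ∈ K, norm2 (f i * u g * f j) ^ 2 with hμ
  have hμ0 : ∀ i j, 0 ≤ μ i j := fun i j => Finset.sum_nonneg fun g _ => sq_nonneg _
  have hp1 := norm_le_one_of_isStarProjection hp
  -- For each `g` the row sum is the squared 2-norm of `f i * u g * p`. The `+ 1` ensures `1 ≤ k`
  -- even for empty `K`.
  have hrow : ∀ i, ∑ j, μ i j ≤ (K.card + 1 : ℝ) * (τ (f i)).re := by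
    intro i
    rw [hμ, Finset.sum_comm]
    have : ∀ g ∈ K, ∑ j, norm2 (f i * u g * f j) ^ 2 ≤ (τ (f i)).re := by
      intro g _
      have h1 := hcut g {i} Finset.univ
      simp only [Finset.sum_singleton, hsum] at h1
      rw [← h1, hw, mul_assoc]
      refine pow_le_pow_left₀ (norm2_nonneg _) ?_ 2
      refine (norm2_mul_le_right (hL i) (mul_mem (u_mem g) hpL)).trans ?_
      refine mul_le_of_le_one_right (norm2_nonneg _) ((norm_mul_le _ _).trans ?_)
      exact mul_le_one₀ (norm_u_le g) (norm_nonneg _) hp1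
    refine (Finset.sum_le_card_nsmul _ _ _ this).trans ?_
    rw [nsmul_eq_mul, hw]
    nlinarith [sq_nonneg (norm2 (f i))]
  have hcol : ∀ j, ∑ i, μ i j ≤ (K.card + 1 : ℝ) * (τ (f j)).re := by
    intro j
    rw [hμ, Finset.sum_comm]
    have : ∀ g ∈ K, ∑ i, norm2 (f i * u g * f j) ^ 2 ≤ (τ (f j)).re := by
      intro g _
      have h1 := hcut g Finset.univ {j}
      simp only [Finset.sum_singleton, hsum] at h1
      rw [← h1, hw]
      refine pow_le_pow_left₀ (norm2_nonneg _) ?_ 2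
      refine (norm2_mul_le_left _ _).trans ?_
      refine mul_le_of_le_one_left (norm2_nonneg _) ((norm_mul_le _ _).trans ?_)
      exact mul_le_one₀ hp1 (norm_nonneg _) (norm_u_le g)
    refine (Finset.sum_le_card_nsmul _ _ _ this).trans ?_
    rw [nsmul_eq_mul, hw]
    nlinarith [sq_nonneg (norm2 (f j))]
  -- The energy is the sum over `g` of the squared compressed commutators of `y`, at most the square
  -- of `commNorm p K y`.
  have hE : ∑ i, ∑ j, (a i - a j) ^ 2 * μ i j ≤ D ^ 2 * ∑ i, a i ^ 2 * (τ (f i)).re := by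
    have e1 : ∑ i, ∑ j, (a i - a j) ^ 2 * μ i j =
        ∑ g ∈ K, norm2 (p * (y * u g - u g * y) * p) ^ 2 := by
      simp only [hμ, Finset.mul_sum]
      have : ∀ i, ∑ j, ∑ g ∈ K, (a i - a j) ^ 2 * norm2 (f i * u g * f j) ^ 2 =
          ∑ g ∈ K, ∑ j, (a i - a j) ^ 2 * norm2 (f i * u g * f j) ^ 2 := fun i => Finset.sum_comm
      simp only [this]
      rw [Finset.sum_comm]
      refine Finset.sum_congr rfl fun g _ => ?_
      rw [hy, sum_smul_comm_eq hf ho hsum, norm2_sq_sum_sum hf hL ho (u_mem g)]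
    rw [e1, hN, ← mul_pow]
    refine (Finset.sum_sq_le_sq_sum_of_nonneg fun g _ => norm2_nonneg _).trans ?_
    exact pow_le_pow_left₀ (commNorm_nonneg p K y) hcomm 2
  obtain ⟨S, hS, hS0, hSμ⟩ := exists_level_set (k := K.card + 1) (fun i => hw i ▸ sq_nonneg _) hμ0
    (by simp) hD hrow hcol (hN ▸ pow_pos hpos 2) hhalf hE
  refine ⟨∑ i ∈ S, f i, sum_mem fun i _ => hL i, isStarProjection_sum hf ho S, ?_, ?_, ?_, ?_⟩
  · rw [← hsum, ← Finset.sum_add_sum_compl S, add_mul,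
      (isStarProjection_sum hf ho S).isIdempotentElem.eq, Finset.sum_mul_sum,
      add_eq_left]
    refine Finset.sum_eq_zero fun i hi => Finset.sum_eq_zero fun j hj => ho i j ?_
    rintro rfl
    exact Finset.mem_compl.1 hi hj
  · rwa [re_τ_sum]
  · rw [re_τ_sum]
    exact hmed S hS
  · intro g hg
    rw [re_τ_sum]
    refine le_trans ?_ hSμ
    have e : p - ∑ i ∈ S, f i = ∑ i ∈ Sᶜ, f i := by
      rw [← hsum, ← Finset.sum_add_sum_compl S, add_sub_cancel_left]
    rw [e, hcut]
    refine Finset.sum_le_sum fun i _ => Finset.sum_le_sum fun j _ => ?_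
    exact Finset.single_le_sum (f := fun g => norm2 (f i * u g * f j) ^ 2)
      (fun g _ => sq_nonneg _) hg

/-- If the gap inequality fails, it already fails on self-adjoint elements. -/
theorem exists_isSelfAdjoint_of_not_hasLocalGap {p : ell2 Γ →L[ℂ] ell2 Γ}
    (hp : IsStarProjection p) (hpL : p ∈ L Γ) {K : Finset Γ} (hK : ∀ g ∈ K, g⁻¹ ∈ K) {κ : ℝ}
    (hκ : 0 < κ) (h : ¬ HasLocalGap p K κ) :
    ∃ x ∈ L Γ, IsSelfAdjoint x ∧ p * x * p = x ∧ τ x = 0 ∧ κ * commNorm p K x < 2 * norm2 x := by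
  simp only [HasLocalGap, not_forall, not_le] at h
  obtain ⟨x, hx, hpx, hτ, hlt⟩ := h
  change κ * commNorm p K x < norm2 x at hlt
  have hxs : star x ∈ L Γ := star_mem hx
  have hpxs : p * star x * p = star x := by
    conv_rhs => rw [← hpx]
    simp only [star_mul, hp.isSelfAdjoint.star_eq, mul_assoc]
  have hτs : τ (star x) = 0 := by rw [τ_star, hτ, star_zero]
  -- Test `x + star x` and `I • (x - star x)`: each has `commNorm` at most twice that of `x`, and
  -- `2x` is recovered from them, so the inequality for `x` follows.
  by_contra! hcon
  have h1 := hcon (x + star x) (add_mem hx hxs) (IsSelfAdjoint.add_star_self x)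
    (by rw [mul_add, add_mul, hpx, hpxs]) (by rw [τ_add, hτ, hτs, add_zero])
  have h2 := hcon (Complex.I • (x - star x)) (smul_mem_L _ (sub_mem hx hxs))
    (by
      rw [IsSelfAdjoint, star_smul, star_sub, star_star, Complex.star_def, Complex.conj_I, neg_smul,
        ← smul_neg, neg_sub])
    (by rw [mul_smul_comm, smul_mul_assoc, mul_sub, sub_mul, hpx, hpxs])
    (by rw [τ_smul, τ_sub, hτ, hτs, sub_zero, mul_zero])
  have h3 := commNorm_add_le p K x (star x)
  have h4 := commNorm_add_le p K x (-star x)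
  rw [commNorm_neg, ← sub_eq_add_neg, commNorm_star hp hpL hK hx] at h4
  rw [commNorm_star hp hpL hK hx] at h3
  rw [norm2_smul, commNorm_smul, Complex.norm_I, one_mul, one_mul] at h2
  have h5 : norm2 ((2 : ℂ) • x) ≤ norm2 (x + star x) + norm2 (x - star x) := by
    refine le_trans (le_of_eq ?_) (norm2_add_le _ _)
    congr 1
    rw [two_smul]
    abel
  rw [norm2_smul, Complex.norm_ofNat] at h5
  have h6 := mul_le_mul_of_nonneg_left h3 hκ.le
  have h7 := mul_le_mul_of_nonneg_left h4 hκ.le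
  linarith

/-- `τ x = 0` and `p * x = x` make `x vacuum` orthogonal to `p vacuum`, so centering cannot shrink
the norm. -/
theorem norm2_le_norm2_sub_smul {p x : ell2 Γ →L[ℂ] ell2 Γ} (hp : IsStarProjection p)
    (hpx : p * x = x) (hτ : τ x = 0) (m : ℂ) : norm2 x ≤ norm2 (x - m • p) := by
  simp only [norm2_eq]
  have hin : inner ℂ (x vacuum) (-(m • p) vacuum) = 0 := by
    have : inner ℂ (p vacuum) (x vacuum) = (0 : ℂ) := by
      rw [← ContinuousLinearMap.adjoint_inner_right, ← ContinuousLinearMap.star_eq_adjoint,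
        hp.isSelfAdjoint.star_eq, ← mul_apply_eq_comp, hpx]
      exact hτ
    rw [inner_neg_right]
    change -inner ℂ (x vacuum) (m • p vacuum) = 0
    rw [inner_smul_right, ← inner_conj_symm, this]
    simp
  have := norm_add_sq_eq_norm_sq_add_norm_sq_of_inner_eq_zero (𝕜 := ℂ) _ _ hin
  rw [← sub_eq_add_neg] at this
  change _ ≤ ‖x vacuum - (m • p) vacuum‖
  refine abs_le_of_sq_le_sq' ?_ (norm_nonneg _) |>.2
  nlinarith [mul_self_nonneg ‖-(m • p) vacuum‖]

/-- If no gap inequality holds on the corner of `p`, then `p` has a nonzero subprojection, of trace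
at most half the trace of `p`, with small boundary relative to `p`. -/
theorem exists_projection_of_no_gap {p : ell2 Γ →L[ℂ] ell2 Γ} (hp : IsStarProjection p)
    (hpL : p ∈ L Γ) (hno : ∀ (K : Finset Γ) (κ : ℝ), 0 < κ → ¬ HasLocalGap p K κ)
    (K : Finset Γ) {c : ℝ} (hc : 0 < c) :
    ∃ r ∈ L Γ, IsStarProjection r ∧ p * r = r ∧ 0 < (τ r).re ∧ 2 * (τ r).re ≤ (τ p).re ∧
      ∀ g ∈ K, norm2 ((p - r) * u g * r) ^ 2 ≤ c * (τ r).re := by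
  classical
  set k : ℝ := K.card + 1 with hk
  have hk1 : 1 ≤ k := by simp [hk]
  -- The cut is made with `D = 4 * δ`, and then `6 * k * D = c`.
  set δ : ℝ := c / (24 * k) with hδ
  have hδ0 : 0 < δ := by positivity
  have hκ : 0 < 2 * δ⁻¹ := by positivity
  obtain ⟨x, hxL, hxs, hpx, hτ, hlt⟩ := exists_isSelfAdjoint_of_not_hasLocalGap hp hpL
    (K := K ∪ K.image fun g => g⁻¹) (by
      intro g hg
      simp only [Finset.mem_union, Finset.mem_image, inv_inj, exists_eq_right] at hg ⊢
      rcases hg with hg | ⟨h, hh, rfl⟩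
      · exact .inr hg
      · exact .inl (by simpa using hh)) hκ (hno _ _ hκ)
  have hFx : commNorm p K x ≤ δ * norm2 x := by
    have h1 := commNorm_mono p (Finset.subset_union_left (s₁ := K) (s₂ := K.image fun g => g⁻¹)) x
    have h2 : commNorm p (K ∪ K.image fun g => g⁻¹) x < δ * norm2 x := by
      rwa [mul_assoc, mul_lt_mul_iff_of_pos_left two_pos, inv_mul_lt_iff₀ hδ0] at hlt
    linarith
  have hN0 : 0 < norm2 x := by
    have := (mul_nonneg hκ.le (commNorm_nonneg _ _ _)).trans_lt hlt
    linarith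
  set N := norm2 x with hN
  have hpx1 : p * x = x := by
    rw [← hpx, ← mul_assoc, ← mul_assoc, hp.isIdempotentElem.eq]
  have hpx2 : x * p = x := by
    rw [← hpx, mul_assoc, hp.isIdempotentElem.eq]
  have hcpx : Commute p x := hpx1.trans hpx2.symm
  -- The first bound keeps `norm2 y ≥ N / 2`; the second keeps the error's commutators within `δ *
  -- N`. Together they give the constant `4 * δ` for `y`.
  set η : ℝ := min (N / 2) (δ * N / (2 * k)) with hη
  have hη0 : 0 < η := by positivity
  obtain ⟨n, hn⟩ := pow_unbounded_of_one_lt (‖x‖ / η) one_lt_two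
  obtain ⟨ι, _, e, a, he, hxe⟩ := exists_resolution hxs n
  have hxη : ‖x - ∑ i, (a i : ℂ) • e i‖ ≤ η := by
    refine hxe.trans ?_
    rw [div_le_iff₀ (by positivity), mul_comm]
    rw [div_lt_iff₀ hη0] at hn
    exact hn.le
  have hcpe : ∀ i, Commute (e i) p := fun i => (he.commute i p hcpx).symm
  -- The `e i` resolve `1`; since they commute with `p`, cutting them by `p` resolves `p`.
  set f : ι → ell2 Γ →L[ℂ] ell2 Γ := fun i => e i * p with hfdef
  have hf : ∀ i, IsStarProjection (f i) := fun i => (he.isStarProjection i).mul hp (hcpe i)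
  have hfL : ∀ i, f i ∈ L Γ := fun i => mul_mem (mem_L_of_commute hxL (he.commute i)) hpL
  have ho : ∀ i j, i ≠ j → f i * f j = 0 := by
    intro i j hij
    change e i * p * (e j * p) = 0
    rw [(hcpe i).eq, mul_assoc, ← mul_assoc (e i), he.mul_eq_zero i j hij, zero_mul, mul_zero]
  have hsum : ∑ i, f i = p := by
    rw [← Finset.sum_mul, he.sum_eq, one_mul]
  have hw : ∀ i, 0 ≤ (τ (f i)).re := fun i => by
    rw [← norm2_sq_of_isStarProjection (hf i)]
    exact sq_nonneg _
  have hwsum : ∑ i, (τ (f i)).re = (τ p).re := by rw [← re_τ_sum, hsum]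
  obtain ⟨m, hm1, hm2⟩ := exists_median (a := a) hw
  set y := ∑ i, ((a i - m : ℝ) : ℂ) • f i with hy
  set z := x - ∑ i, (a i : ℂ) • f i with hz
  have hyz : y = x - (m : ℂ) • p - z := by
    rw [hy, hz, ← hsum]
    simp only [Complex.ofReal_sub, sub_smul, Finset.sum_sub_distrib, Finset.smul_sum]
    abel
  have hzη : ‖z‖ ≤ η := by
    have : z = (x - ∑ i, (a i : ℂ) • e i) * p := by
      rw [hz, sub_mul, hpx2, Finset.sum_mul]
      simp only [smul_mul_assoc, hfdef]
    rw [this]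
    refine (norm_mul_le _ _).trans ?_
    exact (mul_le_of_le_one_right (norm_nonneg _) (norm_le_one_of_isStarProjection hp)).trans hxη
  have hyN : N / 2 ≤ norm2 y := by
    have h1 := norm2_le_norm2_sub_smul hp hpx1 hτ (m : ℂ)
    have h2 : norm2 (x - (m : ℂ) • p) ≤ norm2 y + norm2 z := by
      refine le_trans (le_of_eq ?_) (norm2_add_le _ _)
      rw [hyz, sub_add_cancel]
    have h3 := norm2_le_norm z
    have h4 : η ≤ N / 2 := min_le_left _ _
    linarith
  have hFy : commNorm p K y ≤ 4 * δ * norm2 y := by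
    have e : y = x + ((-m : ℂ) • p + -z) := by
      rw [hyz, neg_smul]
      abel
    have h1 : commNorm p K y ≤ commNorm p K x + commNorm p K z := by
      rw [e]
      refine (commNorm_add_le _ _ _ _).trans (add_le_add le_rfl ?_)
      refine (commNorm_add_le _ _ _ _).trans ?_
      rw [commNorm_smul, commNorm_self hp, commNorm_neg]
      simp
    have h2 := commNorm_le_norm hp K z
    have h3 : (K.card : ℝ) * (2 * ‖z‖) ≤ k * (2 * (δ * N / (2 * k))) := by
      have : η ≤ δ * N / (2 * k) := min_le_right _ _
      have : (K.card : ℝ) ≤ k := by simp [hk]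
      gcongr
      linarith
    have h4 : k * (2 * (δ * N / (2 * k))) = δ * N := by field_simp
    nlinarith
  have hy0 : 0 < norm2 y := by linarith
  have hcδ : 6 * ((K.card : ℝ) + 1) * (4 * δ) = c := by
    rw [hδ, ← hk]
    field_simp
    norm_num
  have hsplit : ∑ i, (a i - m) ^ 2 * (τ (f i)).re = ∑ i, (max (a i - m) 0) ^ 2 * (τ (f i)).re +
      ∑ i, (max (-(a i - m)) 0) ^ 2 * (τ (f i)).re := by
    rw [← Finset.sum_add_distrib]
    refine Finset.sum_congr rfl fun i _ => ?_
    rw [← add_mul]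
    congr 1
    rcases le_total 0 (a i - m) with h | h
    · rw [max_eq_left h, max_eq_right (by linarith)]
      ring
    · rw [max_eq_right h, max_eq_left (by linarith)]
      ring
  rw [← hcδ]
  -- One of the positive and negative parts carries half the mass; the median property bounds the
  -- support of either.
  rcases le_total (∑ i, (max (-(a i - m)) 0) ^ 2 * (τ (f i)).re)
    (∑ i, (max (a i - m) 0) ^ 2 * (τ (f i)).re) with hle | hle
  · refine exists_projection_of_finite_spectrum hp hf hfL ho hsum (a := fun i => a i - m)
      (by positivity) hy0 hFy (fun S hS => ?_) (by linarith)
    rw [← hwsum]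
    exact hm1 S fun i hi => sub_pos.1 (hS i hi)
  · have hneg : ∑ i, ((-(a i - m) : ℝ) : ℂ) • f i = -y := by
      rw [hy]
      simp only [Complex.ofReal_neg, neg_smul, Finset.sum_neg_distrib]
    refine exists_projection_of_finite_spectrum hp hf hfL ho hsum (a := fun i => -(a i - m))
      (D := 4 * δ) (by positivity) ?_ ?_ (fun S hS => ?_) ?_
    · rw [hneg, norm2_neg]
      exact hy0
    · rw [hneg, norm2_neg, commNorm_neg]
      exact hFy
    · rw [← hwsum]
      exact hm2 S fun i hi => by linarith [hS i hi]
    · simp only [neg_sq]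
      linarith

end Cut

/-! ### Accumulating small pieces into a projection of substantial trace. -/

section Exhaustion

/-- Greedy exhaustion: if increasing sequences have upper bounds and `T` is monotone and bounded,
then `T` is maximal at some point above any given one. -/
theorem exists_maximal_of_seq {α : Type*} {R : α → α → Prop} (hrefl : ∀ a, R a a)
    (htrans : ∀ a b c, R a b → R b c → R a c) {T : α → ℝ} (hmono : ∀ a b, R a b → T a ≤ T b)
    {B : ℝ} (hB : ∀ a, T a ≤ B)
    (hseq : ∀ s : ℕ → α, (∀ n, R (s n) (s (n + 1))) → ∃ b, ∀ n, R (s n) b) (a₀ : α) :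
    ∃ a, R a₀ a ∧ ∀ b, R a b → T b ≤ T a := by
  -- Choose `a'` at least halfway from `T a` to the supremum of `T` above `a`.
  have hstep : ∀ a, ∃ a', R a a' ∧ ∀ b, R a b → T b ≤ 2 * T a' - T a := by
    intro a
    have hbdd : BddAbove (T '' {b | R a b}) := ⟨B, by rintro _ ⟨b, _, rfl⟩; exact hB b⟩
    have hle : ∀ b, R a b → T b ≤ sSup (T '' {b | R a b}) := fun b hb =>
      le_csSup hbdd ⟨b, hb, rfl⟩
    rcases (hle a (hrefl a)).lt_or_eq with h | h
    · obtain ⟨_, ⟨a', ha', rfl⟩, hlt⟩ := exists_lt_of_lt_csSup (s := T '' {b | R a b})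
        (b := (T a + sSup (T '' {b | R a b})) / 2) ⟨T a, a, hrefl a, rfl⟩ (by linarith)
      exact ⟨a', ha', fun b hb => by linarith [hle b hb]⟩
    · exact ⟨a, hrefl a, fun b hb => by linarith [hle b hb]⟩
  choose next hnext hnext' using hstep
  set s : ℕ → α := fun n => next^[n] a₀ with hs
  have hsucc : ∀ n, s (n + 1) = next (s n) := fun n => Function.iterate_succ_apply' next n a₀
  have hR : ∀ n, R (s n) (s (n + 1)) := fun n => by
    rw [hsucc]
    exact hnext _
  obtain ⟨b, hb⟩ := hseq s hR
  refine ⟨b, hb 0, fun c hc => ?_⟩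
  have hm : Monotone fun n => T (s n) := monotone_nat_of_le_succ fun n => hmono _ _ (hR n)
  have hbd : BddAbove (Set.range fun n => T (s n)) := ⟨B, by rintro _ ⟨n, rfl⟩; exact hB _⟩
  have hlim := tendsto_atTop_ciSup hm hbd
  have hlim1 := (Filter.tendsto_add_atTop_iff_nat 1).2 hlim
  -- Anything above the bound `b` is above every `s n`; the halfway estimate passes to the limit.
  have h1 : T c ≤ 2 * (⨆ n, T (s n)) - ⨆ n, T (s n) := by
    refine ge_of_tendsto' ((hlim1.const_mul 2).sub hlim) fun n => ?_
    rw [hsucc]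
    exact hnext' _ c (htrans _ _ _ (hb n) hc)
  have h2 : (⨆ n, T (s n)) ≤ T b := ciSup_le fun n => hmono _ _ (hb n)
  linarith

theorem exists_isStarProjection_tendsto {H : Type*} [NormedAddCommGroup H] [InnerProductSpace ℂ H]
    [CompleteSpace H] {q : ℕ → H →L[ℂ] H} (hq : ∀ n, IsStarProjection (q n))
    (hle : ∀ n, q (n + 1) * q n = q n) :
    ∃ Q : H →L[ℂ] H, IsStarProjection Q ∧ (∀ n, Q * q n = q n) ∧
      ∀ ξ, Filter.Tendsto (fun n => q n ξ) Filter.atTop (𝓝 (Q ξ)) := by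
  choose U hU hqU using fun n => isStarProjection_iff_eq_starProjection.1 (hq n)
  have hmem : ∀ n ξ, ξ ∈ U n ↔ q n ξ = ξ := fun n ξ => by
    rw [hqU n, Submodule.starProjection_eq_self_iff]
  have hmono : Monotone U := by
    refine monotone_nat_of_le_succ fun n ξ hξ => ?_
    rw [hmem] at hξ ⊢
    rw [← hξ, ← mul_apply_eq_comp, hle]
  refine ⟨(⨆ n, U n).topologicalClosure.starProjection, isStarProjection_starProjection, ?_, ?_⟩
  · intro n
    ext ξ
    refine Submodule.starProjection_eq_self_iff.2 (Submodule.le_topologicalClosure _ ?_)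
    refine Submodule.mem_iSup_of_mem n ((hmem n _).2 ?_)
    exact congrArg (fun T : H →L[ℂ] H => T ξ) (hq n).isIdempotentElem.eq
  · intro ξ
    have := Submodule.starProjection_tendsto_closure_iSup U hmono ξ
    simpa only [← hqU] using this

theorem mul_eq_right_of_le {A : Type*} [Semigroup A] [StarMul A] {q r : A} (hq : IsStarProjection q)
    (hr : IsStarProjection r) (h : r * q = q) : q * r = q := by
  have := congrArg star h
  rwa [star_mul, hq.isSelfAdjoint.star_eq, hr.isSelfAdjoint.star_eq] at this

variable {Γ : Type u} [Group Γ]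

/-- Commuting with a fixed bounded operator passes to strong limits. -/
theorem mem_L_of_tendsto {q : ℕ → ell2 Γ →L[ℂ] ell2 Γ} (hq : ∀ n, q n ∈ L Γ)
    {Q : ell2 Γ →L[ℂ] ell2 Γ}
    (hlim : ∀ ξ, Filter.Tendsto (fun n => q n ξ) Filter.atTop (𝓝 (Q ξ))) : Q ∈ L Γ := by
  refine mem_L_iff.2 fun b hb => ?_
  ext1 ξ
  refine tendsto_nhds_unique ((b.continuous.tendsto _).comp (hlim ξ)) ?_
  refine (hlim (b ξ)).congr fun n => ?_
  exact congrArg (fun T : ell2 Γ →L[ℂ] ell2 Γ => T ξ) (mem_L_iff.1 (hq n) b hb).eq.symm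

/-- `r` is a projection above `q` such that `r - q` has small boundary relative to `1 - q`. -/
def IsExtension (K : Finset Γ) (c : ℝ) (q r : ell2 Γ →L[ℂ] ell2 Γ) : Prop :=
  r * q = q ∧ ∀ g ∈ K, norm2 ((1 - r) * u g * (r - q)) ^ 2 ≤ c * ((τ r).re - (τ q).re)

theorem IsExtension.refl (K : Finset Γ) (c : ℝ) {q : ell2 Γ →L[ℂ] ell2 Γ}
    (hq : IsStarProjection q) : IsExtension K c q q := by
  refine ⟨hq.isIdempotentElem.eq, fun g _ => ?_⟩
  simp [norm2_eq]

theorem norm2_one_sub_mul_le {r s : ell2 Γ →L[ℂ] ell2 Γ} (hs : IsStarProjection s)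
    (h : s * r = r) (y : ell2 Γ →L[ℂ] ell2 Γ) : norm2 ((1 - s) * y) ≤ norm2 ((1 - r) * y) := by
  have e : (1 - s) * y = (1 - s) * ((1 - r) * y) := by
    rw [← mul_assoc, mul_sub, mul_one, sub_mul 1 s r, one_mul, h, sub_self, sub_zero]
  rw [e]
  exact (norm2_mul_le_left _ _).trans (mul_le_of_le_one_left (norm2_nonneg _)
    (norm_le_one_of_isStarProjection hs.one_sub))

/-- The increments `r - q` and `s - r` are orthogonal, so the squared boundary splits. Enlarging `r`
to `s` only shrinks the first term, and the trace bounds telescope. -/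
theorem IsExtension.trans {K : Finset Γ} {c : ℝ} {q r s : ell2 Γ →L[ℂ] ell2 Γ}
    (hq : IsStarProjection q) (hr : IsStarProjection r) (hs : IsStarProjection s)
    (hqL : q ∈ L Γ) (hrL : r ∈ L Γ) (hsL : s ∈ L Γ)
    (h1 : IsExtension K c q r) (h2 : IsExtension K c r s) : IsExtension K c q s := by
  have hsq : s * q = q := by rw [← h1.1, ← mul_assoc, h2.1]
  refine ⟨hsq, fun g hg => ?_⟩
  have hqs := mul_eq_right_of_le hq hs hsq
  have hqr := mul_eq_right_of_le hq hr h1.1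
  have hrs := mul_eq_right_of_le hr hs h2.1
  set f : Bool → ell2 Γ →L[ℂ] ell2 Γ := fun b => bif b then s - r else r - q with hf
  have hfp : ∀ b, IsStarProjection (f b) := by
    rintro (_ | _)
    · exact IsStarProjection.sub_of_mul_eq_left hq hr hqr
    · exact IsStarProjection.sub_of_mul_eq_left hr hs hrs
  have hfL : ∀ b, f b ∈ L Γ := by
    rintro (_ | _)
    · exact sub_mem hrL hqL
    · exact sub_mem hsL hrL
  have ho : ∀ i j, i ≠ j → f i * f j = 0 := by
    rintro (_ | _) (_ | _) hij
    · exact absurd rfl hij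
    · change (r - q) * (s - r) = 0
      rw [sub_mul, mul_sub, mul_sub, hrs, hr.isIdempotentElem.eq, hqs, hqr]
      abel
    · change (s - r) * (r - q) = 0
      rw [sub_mul, mul_sub, mul_sub, h2.1, hr.isIdempotentElem.eq, hsq, h1.1]
      abel
    · exact absurd rfl hij
  have hsum := norm2_sq_sum_right hfp hfL ho
    (y := fun _ => (1 - s) * u g) (fun _ => mul_mem (sub_mem (one_mem _) hsL) (u_mem g)) Finset.univ
  rw [← Finset.mul_sum] at hsum
  simp only [Fintype.sum_bool, hf, cond_true, cond_false, sub_add_sub_cancel] at hsum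
  rw [hsum]
  have h3 := h2.2 g hg
  have h4 := h1.2 g hg
  have h5 : norm2 ((1 - s) * u g * (r - q)) ^ 2 ≤ norm2 ((1 - r) * u g * (r - q)) ^ 2 := by
    refine pow_le_pow_left₀ (norm2_nonneg _) ?_ 2
    rw [mul_assoc, mul_assoc]
    exact norm2_one_sub_mul_le hs h2.1 _
  linarith

theorem re_τ_le_of_isExtension {K : Finset Γ} {c : ℝ} {q r : ell2 Γ →L[ℂ] ell2 Γ}
    (hq : IsStarProjection q) (hr : IsStarProjection r) (h : IsExtension K c q r) :
    (τ q).re ≤ (τ r).re := by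
  have := norm2_sq_of_isStarProjection
    (IsStarProjection.sub_of_mul_eq_left hq hr (mul_eq_right_of_le hq hr h.1))
  rw [τ_sub, Complex.sub_re] at this
  linarith [sq_nonneg (norm2 (r - q))]

theorem tendsto_τ {q : ℕ → ell2 Γ →L[ℂ] ell2 Γ} {Q : ell2 Γ →L[ℂ] ell2 Γ}
    (hlim : ∀ ξ, Filter.Tendsto (fun n => q n ξ) Filter.atTop (𝓝 (Q ξ))) :
    Filter.Tendsto (fun n => (τ (q n)).re) Filter.atTop (𝓝 (τ Q).re) :=
  (Complex.continuous_re.tendsto _).comp (Filter.Tendsto.inner tendsto_const_nhds (hlim vacuum))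

theorem exists_isExtension_of_seq {K : Finset Γ} {c : ℝ} {q : ℕ → ell2 Γ →L[ℂ] ell2 Γ}
    (hq : ∀ n, IsStarProjection (q n)) (hqL : ∀ n, q n ∈ L Γ)
    (hext : ∀ n, IsExtension K c (q n) (q (n + 1))) {B : ℝ} (hB : ∀ n, (τ (q n)).re ≤ B) :
    ∃ Q ∈ L Γ, IsStarProjection Q ∧ (τ Q).re ≤ B ∧ ∀ n, IsExtension K c (q n) Q := by
  obtain ⟨Q, hQ, hQq, hlim⟩ := exists_isStarProjection_tendsto hq fun n => (hext n).1
  refine ⟨Q, mem_L_of_tendsto hqL hlim, hQ, le_of_tendsto' (tendsto_τ hlim) hB,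
    fun m => ⟨hQq m, fun g hg => ?_⟩⟩
  -- Transitivity gives a bound with constant `c` independent of `k`, which survives the limit.
  have hmn : ∀ k, IsExtension K c (q m) (q (m + k)) := by
    intro k
    induction k with
    | zero => exact IsExtension.refl K c (hq m)
    | succ k ih => exact ih.trans (hq _) (hq _) (hq _) (hqL _) (hqL _) (hqL _) (hext (m + k))
  have hshift : ∀ ξ, Filter.Tendsto (fun k => q (m + k) ξ) Filter.atTop (𝓝 (Q ξ)) := fun ξ => by
    have := (Filter.tendsto_add_atTop_iff_nat m).2 (hlim ξ)
    simpa only [add_comm] using this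
  have h1 : Filter.Tendsto (fun k => norm2 ((1 - Q) * u g * (q (m + k) - q m)) ^ 2) Filter.atTop
      (𝓝 (norm2 ((1 - Q) * u g * (Q - q m)) ^ 2)) := by
    simp only [norm2_eq]
    exact ((((1 - Q) * u g).continuous.tendsto _).comp
      ((hshift vacuum).sub tendsto_const_nhds)).norm.pow 2
  have h2 := ((tendsto_τ hshift).sub_const (τ (q m)).re).const_mul c
  refine le_of_tendsto_of_tendsto' h1 h2 fun k => ?_
  refine le_trans ?_ ((hmn k).2 g hg)
  refine pow_le_pow_left₀ (norm2_nonneg _) ?_ 2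
  rw [mul_assoc, mul_assoc]
  exact norm2_one_sub_mul_le hQ (hQq _) _

/-- If no projection close to `1` satisfies a gap inequality, then there are projections with trace
bounded away from `0` and `1` and with small boundary. -/
theorem exists_projection_of_no_local_gap {ε : ℝ} (hε : 0 < ε)
    (hno : ∀ p ∈ L Γ, IsStarProjection p → norm2 (1 - p) < ε →
      ∀ (K : Finset Γ) (κ : ℝ), 0 < κ → ¬ HasLocalGap p K κ)
    (K : Finset Γ) {c : ℝ} (hc : 0 < c) :
    ∃ r ∈ L Γ, IsStarProjection r ∧ ε ^ 2 ≤ (τ r).re ∧ (τ r).re ≤ (1 + ε ^ 2) / 2 ∧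
      ∀ g ∈ K, norm2 ((1 - r) * u g * r) ^ 2 ≤ c * (τ r).re := by
  -- The cap leaves room for one more step: if `τ r < ε ^ 2`, adding at most half of `1 - τ r` gives
  -- at most `(1 + τ r) / 2`, below the cap.
  let α := {r : ell2 Γ →L[ℂ] ell2 Γ // r ∈ L Γ ∧ IsStarProjection r ∧ (τ r).re ≤ (1 + ε ^ 2) / 2}
  let z : α := ⟨0, zero_mem _, IsStarProjection.zero _, by
    rw [τ_zero, Complex.zero_re]
    positivity⟩
  obtain ⟨⟨r, hrL, hr, hrB⟩, hzr, hmax⟩ := exists_maximal_of_seq (α := α)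
    (R := fun q r => IsExtension K c q.1 r.1) (T := fun r => (τ r.1).re)
    (fun a => IsExtension.refl K c a.2.2.1)
    (fun a b d => IsExtension.trans a.2.2.1 b.2.2.1 d.2.2.1 a.2.1 b.2.1 d.2.1)
    (fun a b => re_τ_le_of_isExtension a.2.2.1 b.2.2.1) (fun a => a.2.2.2)
    (fun s hs => by
      obtain ⟨Q, hQL, hQ, hQB, hQe⟩ := exists_isExtension_of_seq (q := fun n => (s n).1)
        (fun n => (s n).2.2.1) (fun n => (s n).2.1) hs (fun n => (s n).2.2.2)
      exact ⟨⟨Q, hQL, hQ, hQB⟩, hQe⟩) z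
  have hfin : ∀ g ∈ K, norm2 ((1 - r) * u g * r) ^ 2 ≤ c * (τ r).re := by
    intro g hg
    simpa [z] using hzr.2 g hg
  refine ⟨r, hrL, hr, ?_, hrB, hfin⟩
  by_contra! hlt
  have hp := hr.one_sub
  have hpL : 1 - r ∈ L Γ := sub_mem (one_mem _) hrL
  obtain ⟨r₀, hr₀L, hr₀, hpr₀, hpos, hhalf, hbd⟩ := exists_projection_of_no_gap hp hpL
    (hno _ hpL hp (by
      rw [sub_sub_cancel]
      refine lt_of_pow_lt_pow_left₀ 2 hε.le ?_
      rwa [norm2_sq_of_isStarProjection hr])) K hc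
  rw [τ_sub, τ_one, Complex.sub_re, Complex.one_re] at hhalf
  have h0 : r * r₀ = 0 := by
    rw [← hpr₀, ← mul_assoc, hr.mul_one_sub_self, zero_mul]
  have hadd : IsStarProjection (r + r₀) := hr.add hr₀ h0
  have h0' : r₀ * r = 0 := by
    have := congrArg star h0
    rwa [star_mul, hr.isSelfAdjoint.star_eq, hr₀.isSelfAdjoint.star_eq, star_zero] at this
  have hτ : (τ (r + r₀)).re = (τ r).re + (τ r₀).re := by rw [τ_add, Complex.add_re]
  -- The boundary of the increment `r₀` relative to `1 - (r + r₀)` is exactly its boundary inside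
  -- the corner of `1 - r`.
  have := hmax ⟨r + r₀, add_mem hrL hr₀L, hadd, by rw [hτ]; linarith⟩
    ⟨by simp only [add_mul, hr.isIdempotentElem.eq, h0', add_zero], fun g hg => by
      simp only [hτ, add_sub_cancel_left, ← sub_sub]
      exact hbd g hg⟩
  simp only [hτ] at this
  linarith

end Exhaustion

/-! ### Almost central projections and the contradiction with fullness. -/

section Full

variable {Γ : Type u} [Group Γ]

/-- The commutator with `u g` is the difference of the two off-diagonal corners, one being the
adjoint of a boundary term for `g⁻¹`; hence `K` is symmetrized. -/
theorem exists_almost_central_projection {ε : ℝ} (hε : 0 < ε)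
    (hno : ∀ p ∈ L Γ, IsStarProjection p → norm2 (1 - p) < ε →
      ∀ (K : Finset Γ) (κ : ℝ), 0 < κ → ¬ HasLocalGap p K κ)
    (K : Finset Γ) {δ : ℝ} (hδ : 0 < δ) :
    ∃ r ∈ L Γ, IsStarProjection r ∧ ε ^ 2 ≤ (τ r).re ∧ (τ r).re ≤ (1 + ε ^ 2) / 2 ∧
      ∀ g ∈ K, norm2 (r * u g - u g * r) ≤ δ := by
  classical
  obtain ⟨r, hrL, hr, h1, h2, h3⟩ := exists_projection_of_no_local_gap hε hno
    (K ∪ K.image fun g => g⁻¹) (c := (δ / 2) ^ 2) (by positivity)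
  refine ⟨r, hrL, hr, h1, h2, fun g hg => ?_⟩
  have hr1 : (τ r).re ≤ 1 := by
    rw [← norm2_sq_of_isStarProjection hr]
    refine pow_le_one₀ (norm2_nonneg _) ?_
    exact (norm2_le_norm _).trans (norm_le_one_of_isStarProjection hr)
  have h4 : ∀ g ∈ K ∪ K.image fun g => g⁻¹, norm2 ((1 - r) * u g * r) ≤ δ / 2 := by
    intro g hg
    refine le_of_sq_le_sq ?_ (by positivity)
    exact (h3 g hg).trans (mul_le_of_le_one_right (by positivity) hr1)
  have h5 := h4 g (by simp [hg])
  have h6 := h4 g⁻¹ (by simp [hg])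
  rw [← norm2_star (mul_mem (mul_mem (sub_mem (one_mem _) hrL) (u_mem _)) hrL)] at h6
  have e : r * u g - u g * r = star ((1 - r) * u g⁻¹ * r) - (1 - r) * u g * r := by
    simp only [star_mul, star_sub, star_one, star_u, inv_inv, hr.isSelfAdjoint.star_eq]
    noncomm_ring
  rw [e]
  refine (norm2_sub_le _ _).trans ?_
  linarith

/-- Truncating the Fourier series of `a` approximates it in 2-norm, without controlling the operator
norm. -/
theorem exists_norm2_sub_sum_lt {a : ell2 Γ →L[ℂ] ell2 Γ} {δ : ℝ} (hδ : 0 < δ) :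
    ∃ s : Finset Γ, norm2 (a - ∑ g ∈ s, a vacuum g • u g) < δ := by
  classical
  obtain ⟨s, hs⟩ := (Metric.tendsto_atTop.1
    (lp.hasSum_single (p := 2) (by norm_num) (a vacuum)) δ hδ)
  refine ⟨s, ?_⟩
  have h1 := hs s le_rfl
  rw [dist_comm, dist_eq_norm] at h1
  have e : (∑ g ∈ s, a vacuum g • u g) vacuum = ∑ g ∈ s, lp.single 2 g (a vacuum g) := by
    rw [sum_apply]
    refine Finset.sum_congr rfl fun g _ => ?_
    rw [smul_apply, u_vacuum, smul_basisVec]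
  rw [norm2_eq, sub_apply, e]
  exact h1

/-- A bounded net in `L(Γ)` that asymptotically commutes with all `u_g` asymptotically commutes with
all of `L(Γ)`. -/
theorem tendsto_commutator {ι : Type*} {l : Filter ι} {x : ι → ell2 Γ →L[ℂ] ell2 Γ}
    (hx : ∀ i, x i ∈ L Γ) (hx1 : ∀ i, ‖x i‖ ≤ 1)
    (hu : ∀ g : Γ, Filter.Tendsto (fun i => norm2 (x i * u g - u g * x i)) l (𝓝 0))
    {a : ell2 Γ →L[ℂ] ell2 Γ} (ha : a ∈ L Γ) :
    Filter.Tendsto (fun i => norm2 (x i * a - a * x i)) l (𝓝 0) := by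
  rw [Metric.tendsto_nhds]
  intro δ hδ
  -- One quarter of `δ` goes to the commutator with `b`, and one to each of the two products with `a
  -- - b`.
  obtain ⟨s, hs⟩ := exists_norm2_sub_sum_lt (a := a) (δ := δ / 4) (by positivity)
  set b := ∑ g ∈ s, a vacuum g • u g with hb
  have hbL : b ∈ L Γ := sum_mem fun g _ => smul_mem_L _ (u_mem g)
  have h1 : Filter.Tendsto
      (fun i => ∑ g ∈ s, ‖a vacuum g‖ * norm2 (x i * u g - u g * x i)) l (𝓝 0) := by
    have := tendsto_finsetSum s fun g _ => (hu g).const_mul ‖a vacuum g‖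
    simpa using this
  have h2 : ∀ i, norm2 (x i * b - b * x i) ≤
      ∑ g ∈ s, ‖a vacuum g‖ * norm2 (x i * u g - u g * x i) := by
    intro i
    have e : x i * b - b * x i = ∑ g ∈ s, a vacuum g • (x i * u g - u g * x i) := by
      simp only [hb, Finset.mul_sum, Finset.sum_mul, ← Finset.sum_sub_distrib, mul_smul_comm,
        smul_mul_assoc, smul_sub]
    rw [e, norm2_eq, sum_apply]
    refine (norm_sum_le _ _).trans (Finset.sum_le_sum fun g _ => ?_)
    rw [← norm2_eq, norm2_smul]
  filter_upwards [(Metric.tendsto_nhds.1 h1) (δ / 4) (by positivity)] with i hi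
  rw [Real.dist_eq, sub_zero] at hi ⊢
  rw [abs_of_nonneg (norm2_nonneg _)]
  have h3 := (le_abs_self _).trans_lt hi
  have e : x i * a - a * x i = (x i * b - b * x i) + (x i * (a - b) - (a - b) * x i) := by
    noncomm_ring
  have h4 : norm2 (x i * (a - b)) ≤ norm2 (a - b) :=
    (norm2_mul_le_left _ _).trans (mul_le_of_le_one_left (norm2_nonneg _) (hx1 i))
  have h5 : norm2 ((a - b) * x i) ≤ norm2 (a - b) :=
    (norm2_mul_le_right (sub_mem ha hbL) (hx i)).trans
      (mul_le_of_le_one_right (norm2_nonneg _) (hx1 i))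
  have h6 := norm2_add_le (x i * b - b * x i) (x i * (a - b) - (a - b) * x i)
  have h7 := norm2_sub_le (x i * (a - b)) ((a - b) * x i)
  have h8 := h2 i
  rw [e]
  linarith

/-- The variance of an indicator function of mass `τ r`. -/
theorem norm2_sub_τ_sq {r : ell2 Γ →L[ℂ] ell2 Γ} (hr : IsStarProjection r) :
    norm2 (r - τ r • 1) ^ 2 = (τ r).re * (1 - (τ r).re) := by
  have him : τ r = ((τ r).re : ℂ) := by
    have := τ_star r
    rw [hr.isSelfAdjoint.star_eq] at this
    exact (Complex.conj_eq_iff_re.1 this.symm).symm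
  set t := (τ r).re with ht
  have e : star (r - (t : ℂ) • 1) * (r - (t : ℂ) • 1) = r - (t : ℂ) • r - (t : ℂ) • r +
      ((t : ℂ) * t) • 1 := by
    simp only [star_sub, star_smul, star_one, hr.isSelfAdjoint.star_eq, Complex.star_def,
      Complex.conj_ofReal, mul_sub, sub_mul, hr.isIdempotentElem.eq, mul_smul_comm, smul_mul_assoc,
      mul_one, one_mul, smul_smul, smul_sub]
    abel
  rw [him, norm2_sq, e, τ_add, τ_sub, τ_sub, τ_smul, τ_smul, τ_one, him, mul_one]
  simp only [← Complex.ofReal_mul, ← Complex.ofReal_sub, ← Complex.ofReal_add, Complex.ofReal_re]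
  ring

/-- If `L(Γ)` is full, then projections arbitrarily close to `1` satisfy a gap inequality. -/
theorem exists_hasLocalGap_of_isFull (hfull : IsFull Γ) {ε : ℝ} (hε : 0 < ε) :
    ∃ p ∈ L Γ, IsStarProjection p ∧ norm2 (1 - p) < ε ∧
      ∃ (K : Finset Γ) (κ : ℝ), 0 < κ ∧ HasLocalGap p K κ := by
  classical
  by_contra! hcon
  -- With `ε' ≤ 1/2` the traces are at most `5/8`, so the variance is at least `ε' ^ 2 * (3 / 8)`.
  set ε' := min ε (1 / 2) with hε'
  have hε'0 : 0 < ε' := by positivity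
  have hno : ∀ p ∈ L Γ, IsStarProjection p → norm2 (1 - p) < ε' →
      ∀ (K : Finset Γ) (κ : ℝ), 0 < κ → ¬ HasLocalGap p K κ := fun p hpL hp hlt =>
    hcon p hpL hp (hlt.trans_le (min_le_left _ _))
  choose r hrL hr hlow hup hcomm using fun i : Finset Γ × ℕ =>
    exists_almost_central_projection hε'0 hno i.1 (δ := 1 / ((i.2 : ℝ) + 1)) (by positivity)
  have hu : ∀ g : Γ, Filter.Tendsto (fun i => norm2 (r i * u g - u g * r i)) Filter.atTop
      (𝓝 0) := by
    intro g
    have h1 : Filter.Tendsto (fun i : Finset Γ × ℕ => 1 / ((i.2 : ℝ) + 1)) Filter.atTop (𝓝 0) := by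
      rw [← Filter.prod_atTop_atTop_eq]
      exact tendsto_one_div_add_atTop_nhds_zero_nat.comp Filter.tendsto_snd
    refine squeeze_zero' (Filter.Eventually.of_forall fun i => norm2_nonneg _) ?_ h1
    filter_upwards [Filter.eventually_ge_atTop (({g}, 0) : Finset Γ × ℕ)] with i hi
    exact hcomm i g (hi.1 (Finset.mem_singleton_self g))
  have hlim := hfull (Finset Γ × ℕ) r hrL ⟨1, fun i => norm_le_one_of_isStarProjection (hr i)⟩
    fun a ha => tendsto_commutator hrL (fun i => norm_le_one_of_isStarProjection (hr i)) hu ha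
  have hlim2 := hlim.pow 2
  have hle : ∀ i, ε' ^ 2 * (3 / 8) ≤ norm2 (r i - τ (r i) • 1) ^ 2 := by
    intro i
    rw [norm2_sub_τ_sq (hr i)]
    have h1 : ε' ≤ 1 / 2 := min_le_right _ _
    have h2 : ε' ^ 2 ≤ 1 / 4 := by nlinarith
    have h3 := hup i
    exact mul_le_mul (hlow i) (by linarith) (by norm_num) ((sq_nonneg _).trans (hlow i))
  have := ge_of_tendsto' hlim2 hle
  have : 0 < ε' ^ 2 * (3 / 8) := by positivity
  linarith

end Full

/-! ### Conjugation-invariant means and the gap for `p = 1`. -/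

section InnerAmenable

variable {Γ : Type u}

theorem hasSum_norm_sq (ξ : ell2 Γ) : HasSum (fun h => ‖ξ h‖ ^ 2) (‖ξ‖ ^ 2) := by
  have := lp.hasSum_norm (p := 2) (by norm_num) ξ
  simpa using this

theorem abs_apply_le_norm (f : lp (fun _ : Γ => ℝ) ∞) (h : Γ) : |f h| ≤ ‖f‖ :=
  lp.norm_apply_le_norm ENNReal.top_ne_zero f h

/-- The state `f ↦ ∑ |ξ(h)|² f(h)` on `ℓ^∞(Γ)` given by a vector `ξ`. -/
noncomputable def vectorState (ξ : ell2 Γ) (f : lp (fun _ : Γ => ℝ) ∞) : ℝ := ∑' h, ‖ξ h‖ ^ 2 * f h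

theorem summable_vectorState (ξ : ell2 Γ) (f : lp (fun _ : Γ => ℝ) ∞) :
    Summable fun h => ‖ξ h‖ ^ 2 * f h := by
  refine Summable.of_norm_bounded ((hasSum_norm_sq ξ).summable.mul_right ‖f‖) fun h => ?_
  rw [norm_mul, norm_pow, norm_norm]
  exact mul_le_mul_of_nonneg_left (abs_apply_le_norm f h) (sq_nonneg _)

theorem abs_vectorState_le (ξ : ell2 Γ) (f : lp (fun _ : Γ => ℝ) ∞) :
    |vectorState ξ f| ≤ ‖ξ‖ ^ 2 * ‖f‖ := by
  rw [← Real.norm_eq_abs]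
  refine tsum_of_norm_bounded ((hasSum_norm_sq ξ).mul_right ‖f‖) fun h => ?_
  rw [norm_mul, norm_pow, norm_norm]
  exact mul_le_mul_of_nonneg_left (abs_apply_le_norm f h) (sq_nonneg _)

/-- Unit vectors at distance at most `δ` have states at distance at most `5 δ / 2`. -/
theorem abs_vectorState_sub_le {ξ η : ell2 Γ} (hξ : ‖ξ‖ = 1) (hη : ‖η‖ = 1) {δ : ℝ} (hδ : 0 < δ)
    (h : ‖ξ - η‖ ≤ δ) (f : lp (fun _ : Γ => ℝ) ∞) :
    |vectorState ξ f - vectorState η f| ≤ 5 / 2 * δ * ‖f‖ := by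
  rw [vectorState, vectorState,
    ← (summable_vectorState ξ f).tsum_sub (summable_vectorState η f)]
  -- A pointwise weighted AM-GM bound for the difference of squared moduli; its sum is at most `δ /
  -- 2 + 2 * δ`, times `‖f‖`.
  have hs : HasSum (fun h => (δ⁻¹ / 2 * ‖(ξ - η) h‖ ^ 2 + δ * (‖ξ h‖ ^ 2 + ‖η h‖ ^ 2)) * ‖f‖)
      ((δ⁻¹ / 2 * ‖ξ - η‖ ^ 2 + δ * (‖ξ‖ ^ 2 + ‖η‖ ^ 2)) * ‖f‖) :=
    (((hasSum_norm_sq (ξ - η)).mul_left _).add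
      (((hasSum_norm_sq ξ).add (hasSum_norm_sq η)).mul_left _)).mul_right _
  rw [← Real.norm_eq_abs]
  refine (tsum_of_norm_bounded hs fun k => ?_).trans ?_
  · rw [← sub_mul, norm_mul]
    refine mul_le_mul ?_ (abs_apply_le_norm f k) (norm_nonneg _) (by positivity)
    rw [lp.coeFn_sub, Pi.sub_apply, Real.norm_eq_abs]
    set a := ‖ξ k‖
    set b := ‖η k‖
    set d := ‖ξ k - η k‖
    have h1 : |a - b| ≤ d := abs_norm_sub_norm_le _ _
    have ha : 0 ≤ a := norm_nonneg _
    have hb : 0 ≤ b := norm_nonneg _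
    have hd : 0 ≤ d := norm_nonneg _
    have h2 : |a ^ 2 - b ^ 2| ≤ d * (a + b) := by
      rw [sq_sub_sq, abs_mul, abs_of_nonneg (add_nonneg ha hb), mul_comm]
      exact mul_le_mul_of_nonneg_right h1 (add_nonneg ha hb)
    have h3 : d * (a + b) ≤ δ⁻¹ / 2 * d ^ 2 + δ / 2 * (a + b) ^ 2 := by
      have h4 : 0 ≤ δ⁻¹ * (d - δ * (a + b)) ^ 2 := by positivity
      have h5 : δ⁻¹ * (d - δ * (a + b)) ^ 2 =
          δ⁻¹ * d ^ 2 - 2 * (δ⁻¹ * δ) * (d * (a + b)) + (δ⁻¹ * δ) * δ * (a + b) ^ 2 := by ring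
      rw [h5, inv_mul_cancel₀ hδ.ne'] at h4
      linarith
    nlinarith [mul_nonneg hδ.le (sq_nonneg (a - b))]
  · refine mul_le_mul_of_nonneg_right ?_ (norm_nonneg f)
    rw [hξ, hη]
    have h1 : δ⁻¹ / 2 * ‖ξ - η‖ ^ 2 ≤ δ⁻¹ / 2 * δ ^ 2 :=
      mul_le_mul_of_nonneg_left (pow_le_pow_left₀ (norm_nonneg _) h 2) (by positivity)
    have h2 : δ⁻¹ / 2 * δ ^ 2 = δ / 2 := by field_simp
    linarith

variable [Group Γ]

/-- The conjugation action `(Ad_g ξ)(h) = ξ(g⁻¹ h g)` on `ℓ²(Γ)`. -/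
noncomputable def conjTranslation (g : Γ) (ξ : ell2 Γ) : ell2 Γ := rightTranslation g (u g ξ)

theorem conjTranslation_apply (g : Γ) (ξ : ell2 Γ) (h : Γ) :
    conjTranslation g ξ h = ξ (g⁻¹ * h * g) := by
  simp [conjTranslation, mul_assoc]

theorem norm_conjTranslation (g : Γ) (ξ : ell2 Γ) : ‖conjTranslation g ξ‖ = ‖ξ‖ := by
  rw [conjTranslation, LinearIsometry.norm_map, norm_u_apply]

/-- The isometric right translation by `g` takes `x δ_g` back to `x δ_1` and `u g (x δ_1)` to its
conjugate. -/
theorem norm2_commutator_u {x : ell2 Γ →L[ℂ] ell2 Γ} (hx : x ∈ L Γ) (g : Γ) :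
    norm2 (x * u g - u g * x) = ‖x vacuum - conjTranslation g (x vacuum)‖ := by
  have e : x vacuum - conjTranslation g (x vacuum) =
      rightTranslation g ((x * u g - u g * x) vacuum) := by
    rw [sub_apply, mul_apply_eq_comp, mul_apply_eq_comp, u_vacuum, apply_basisVec hx, map_sub]
    congr 1
    ext h
    simp
  rw [e, LinearIsometry.norm_map, norm2_eq]

theorem vectorState_conjFun (ξ : ell2 Γ) (g : Γ) (f : lp (fun _ : Γ => ℝ) ∞) :
    vectorState (conjTranslation g ξ) (conjFun g f) = vectorState ξ f := by
  rw [vectorState, vectorState, ← (MulAut.conj g).toEquiv.tsum_eq]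
  refine tsum_congr fun h => ?_
  rw [conjTranslation_apply]
  simp [conjFun, mul_assoc]

/-- A net of almost conjugation-invariant unit vectors vanishing at `1` yields inner amenability. -/
theorem isInnerAmenable_of_almost_invariant
    (h : ∀ (K : Finset Γ) (δ : ℝ), 0 < δ → ∃ ξ : ell2 Γ, ‖ξ‖ = 1 ∧ ξ 1 = 0 ∧
      ∀ g ∈ K, ‖ξ - conjTranslation g ξ‖ ≤ δ) : IsInnerAmenable Γ := by
  classical
  choose ξ hξ1 hξ0 hξ using fun i : Finset Γ × ℕ => h i.1 (1 / ((i.2 : ℝ) + 1)) (by positivity)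
  -- Along an ultrafilter every bounded family of values converges, so the limit is automatically
  -- linear.
  set U : Ultrafilter (Finset Γ × ℕ) := Ultrafilter.of Filter.atTop with hU
  have hlim : ∀ f, ∃ l, Filter.Tendsto (fun i => vectorState (ξ i) f) U (𝓝 l) := by
    intro f
    obtain ⟨l, _, hl⟩ := (isCompact_Icc (a := -‖f‖) (b := ‖f‖)).ultrafilter_le_nhds'
      (U.map fun i => vectorState (ξ i) f) (by
        change ∀ᶠ i in (U : Filter _), vectorState (ξ i) f ∈ Set.Icc (-‖f‖) ‖f‖
        refine Filter.Eventually.of_forall fun i => ?_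
        have := abs_vectorState_le (ξ i) f
        rw [hξ1, one_pow, one_mul] at this
        exact abs_le.1 this)
    exact ⟨l, hl⟩
  choose m hm using hlim
  refine ⟨{ toFun := m, map_add' := fun f f' => ?_, map_smul' := fun c f => ?_ }, ?_, ?_, ?_, ?_⟩
  · refine tendsto_nhds_unique (hm (f + f')) (((hm f).add (hm f')).congr fun i => ?_)
    rw [vectorState, vectorState, vectorState,
      ← (summable_vectorState _ f).tsum_add (summable_vectorState _ f')]
    refine tsum_congr fun k => ?_
    rw [lp.coeFn_add, Pi.add_apply, mul_add]
  · refine tendsto_nhds_unique (hm (c • f)) (((hm f).const_mul c).congr fun i => ?_)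
    rw [vectorState, vectorState, ← tsum_mul_left]
    refine tsum_congr fun k => ?_
    rw [lp.coeFn_smul, Pi.smul_apply, smul_eq_mul]
    ring
  · intro f hf
    exact ge_of_tendsto' (hm f) fun i => tsum_nonneg fun k => mul_nonneg (sq_nonneg _) (hf k)
  · refine tendsto_nhds_unique (hm 1) (tendsto_const_nhds.congr fun i => ?_)
    have := (hasSum_norm_sq (ξ i)).tsum_eq
    rw [hξ1, one_pow] at this
    rw [vectorState, ← this]
    refine tsum_congr fun k => ?_
    rw [lp.infty_coeFn_one, Pi.one_apply, mul_one]
  · refine tendsto_nhds_unique (hm _) (tendsto_const_nhds.congr fun i => ?_)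
    rw [vectorState, eq_comm]
    convert tsum_zero with k
    by_cases hk : k = 1
    · rw [hk, hξ0]
      simp
    · rw [lp.single_apply_ne _ _ _ hk, mul_zero]
  · intro g f
    have h1 : Filter.Tendsto (fun i => vectorState (ξ i) (conjFun g f) - vectorState (ξ i) f) U
        (𝓝 0) := by
      have h2 : Filter.Tendsto (fun i : Finset Γ × ℕ =>
          5 / 2 * (1 / ((i.2 : ℝ) + 1)) * ‖conjFun g f‖) U (𝓝 0) := by
        have : Filter.Tendsto (fun i : Finset Γ × ℕ => 1 / ((i.2 : ℝ) + 1)) Filter.atTop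
            (𝓝 0) := by
          rw [← Filter.prod_atTop_atTop_eq]
          exact tendsto_one_div_add_atTop_nhds_zero_nat.comp Filter.tendsto_snd
        have := ((this.mono_left (Ultrafilter.of_le Filter.atTop)).const_mul (5 / 2)).mul_const
          ‖conjFun g f‖
        simpa using this
      refine squeeze_zero_norm' ?_ h2
      have hev : ∀ᶠ i : Finset Γ × ℕ in U, ({g}, 0) ≤ i :=
        Ultrafilter.of_le Filter.atTop (Filter.eventually_ge_atTop _)
      filter_upwards [hev] with i hi
      -- By equivariance, this compares the states of `ξ i` and of its conjugate on the single
      -- function `conjFun g f`.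
      rw [← vectorState_conjFun (ξ i) g f]
      exact abs_vectorState_sub_le (hξ1 i) (by rw [norm_conjTranslation, hξ1]) (by positivity)
        (hξ i g (hi.1 (Finset.mem_singleton_self g))) _
    have h3 := tendsto_nhds_unique ((hm (conjFun g f)).sub (hm f)) h1
    exact sub_eq_zero.1 h3

/-- A normalized counterexample to the gap with constant `δ⁻¹` is a `δ`-invariant unit vector; its
coefficient at `1` is its trace, hence zero. -/
theorem hasLocalGap_of_not_isInnerAmenable (h : ¬ IsInnerAmenable Γ) :
    ∃ (K : Finset Γ) (κ : ℝ), 0 < κ ∧ HasLocalGap (1 : ell2 Γ →L[ℂ] ell2 Γ) K κ := by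
  by_contra! hcon
  refine h (isInnerAmenable_of_almost_invariant fun K δ hδ => ?_)
  have := hcon K δ⁻¹ (inv_pos.2 hδ)
  simp only [HasLocalGap, not_forall, not_le, one_mul, mul_one] at this
  obtain ⟨x, hx, -, hτ, hlt⟩ := this
  have hsum0 : 0 ≤ ∑ g ∈ K, norm2 (x * u g - u g * x) := Finset.sum_nonneg fun _ _ => norm2_nonneg _
  have hN : 0 < norm2 x := (mul_nonneg (inv_nonneg.2 hδ.le) hsum0).trans_lt hlt
  rw [inv_mul_lt_iff₀ hδ] at hlt
  set c : ℂ := (((norm2 x)⁻¹ : ℝ) : ℂ) with hc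
  have hcn : ‖c‖ = (norm2 x)⁻¹ := by
    rw [hc, Complex.norm_real, Real.norm_of_nonneg (inv_nonneg.2 hN.le)]
  have hcx := smul_mem_L c hx
  refine ⟨(c • x) vacuum, ?_, ?_, fun g hg => ?_⟩
  · rw [← norm2_eq, norm2_smul, hcn, inv_mul_cancel₀ hN.ne']
  · rw [← τ_eq_inner, τ_smul, hτ, mul_zero]
  · rw [← norm2_commutator_u hcx, smul_mul_assoc, mul_smul_comm, ← smul_sub, norm2_smul, hcn,
      inv_mul_le_iff₀ hN, mul_comm]
    exact (Finset.single_le_sum (f := fun g => norm2 (x * u g - u g * x))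
      (fun _ _ => norm2_nonneg _) hg).trans hlt.le

/-- The family `(δ_{ghg⁻¹} - δ_h)_{g ∈ K}` in `ℓ¹(Γ)`. -/
noncomputable def conjDefect (K : Finset Γ) (h : Γ) : K → lp (fun _ : Γ => ℝ) 1 := by
  classical
  exact fun g => lp.single 1 (g.1 * h * g.1⁻¹) 1 - lp.single 1 h 1

theorem linearCombination_conjDefect_apply (K : Finset Γ) (ω : Γ →₀ ℝ) (g : K) (k : Γ) :
    Finsupp.linearCombination ℝ (conjDefect K) ω g k = ω (g.1⁻¹ * k * g.1) - ω k := by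
  classical
  induction ω using Finsupp.induction_linear with
  | zero => simp
  | add ω ω' h h' =>
    rw [map_add, Pi.add_apply, lp.coeFn_add, Pi.add_apply, h, h', Finsupp.add_apply,
      Finsupp.add_apply]
    ring
  | single h c =>
    rw [Finsupp.linearCombination_single, Pi.smul_apply, lp.coeFn_smul, Pi.smul_apply, conjDefect,
      lp.coeFn_sub, Pi.sub_apply, lp.single_apply, lp.single_apply, Finsupp.single_apply,
      Finsupp.single_apply]
    have h1 : k = g.1 * h * g.1⁻¹ ↔ h = g.1⁻¹ * k * g.1 := by
      constructor
      · rintro rfl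
        group
      · rintro rfl
        group
    simp only [Pi.single_apply, h1, eq_comm (a := k), smul_eq_mul]
    split_ifs <;> simp

/-- The finitely supported probability measures on `Γ \ {1}`. -/
def probMeasures (Γ : Type u) [Group Γ] : Set (Γ →₀ ℝ) :=
  {ω | (∀ h, 0 ≤ ω h) ∧ ω.sum (fun _ c => c) = 1 ∧ ω 1 = 0}

theorem convex_probMeasures : Convex ℝ (probMeasures Γ) := by
  rintro ω ⟨h1, h2, h3⟩ ω' ⟨h1', h2', h3'⟩ a b ha hb hab
  refine ⟨fun h => ?_, ?_, ?_⟩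
  · exact add_nonneg (mul_nonneg ha (h1 h)) (mul_nonneg hb (h1' h))
  · rw [Finsupp.sum_add_index' (by simp) (by simp), Finsupp.sum_smul_index (by simp),
      Finsupp.sum_smul_index (by simp), ← Finsupp.mul_sum, ← Finsupp.mul_sum, h2, h2']
    linarith
  · simp [h3, h3']

/-- In an inner amenable group, finitely supported probability measures on `Γ \ {1}` can be almost
conjugation invariant in `ℓ¹`-norm. -/
theorem exists_almost_invariant_measure (hΓ : IsInnerAmenable Γ) (K : Finset Γ) {δ : ℝ}
    (hδ : 0 < δ) :
    ∃ ω ∈ probMeasures Γ, ‖Finsupp.linearCombination ℝ (conjDefect K) ω‖ < δ := by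
  classical
  obtain ⟨m, hpos, hone, hsing, hinv⟩ := hΓ
  set Φ := Finsupp.linearCombination ℝ (conjDefect K) with hΦ
  set C := closure (Φ '' probMeasures Γ) with hC
  suffices h0 : (0 : K → lp (fun _ : Γ => ℝ) 1) ∈ C by
    obtain ⟨_, ⟨ω, hω, rfl⟩, hlt⟩ := Metric.mem_closure_iff.1 h0 δ hδ
    refine ⟨ω, hω, ?_⟩
    rwa [dist_zero_left] at hlt
  -- Day's convexity trick: separate `0` from the closed convex set of defects.
  by_contra h0
  obtain ⟨φ, t, ht0, htC⟩ := geometric_hahn_banach_point_closed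
    (convex_probMeasures.linear_image Φ).closure isClosed_closure h0
  rw [map_zero] at ht0
  have hsingle : ∀ h : Γ, h ≠ 1 → t < φ (conjDefect K h) := by
    intro h hh
    refine htC _ (subset_closure ⟨Finsupp.single h 1, ⟨fun k => ?_, by simp, ?_⟩, ?_⟩)
    · rw [Finsupp.single_apply]
      split_ifs <;> norm_num
    · rw [Finsupp.single_apply, if_neg hh]
    · rw [hΦ, Finsupp.linearCombination_single, one_smul]
  -- The components of `φ` are bounded functions. `G` exceeds `t > 0` off the identity, yet is a sum
  -- of differences that the invariant mean kills.
  let F : K → lp (fun _ : Γ => ℝ) ∞ := fun g =>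
    ⟨fun h => φ (Pi.single g (lp.single 1 h 1)), by
      refine memℓp_infty ⟨‖φ‖, ?_⟩
      rintro _ ⟨h, rfl⟩
      refine (φ.le_opNorm _).trans ?_
      rw [Pi.norm_single, lp.norm_single (by norm_num)]
      simp⟩
  have hF : ∀ g h, F g h = φ (Pi.single g (lp.single 1 h 1)) := fun _ _ => rfl
  set G : lp (fun _ : Γ => ℝ) ∞ := ∑ g : K, (conjFun g.1⁻¹ (F g) - F g) with hG
  have hGφ : ∀ h, G h = φ (conjDefect K h) := by
    intro h
    have e : conjDefect K h = ∑ g : K, Pi.single g (conjDefect K h g) :=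
      (Finset.univ_sum_single _).symm
    rw [e, map_sum, hG, lp.coeFn_sum, Finset.sum_apply]
    refine Finset.sum_congr rfl fun g _ => ?_
    rw [lp.coeFn_sub, Pi.sub_apply, conjDefect, Pi.single_sub, map_sub, hF]
    congr 1
    change F g (g.1⁻¹⁻¹ * h * g.1⁻¹) = _
    rw [inv_inv, hF]
  have hmG : m G = 0 := by
    rw [hG, map_sum]
    refine Finset.sum_eq_zero fun g _ => ?_
    rw [map_sub, hinv, sub_self]
  -- The correction handles the identity, where `G > t` need not hold; `m` vanishes on it, so
  -- positivity forces `t ≤ 0`.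
  have hnonneg := hpos (G - t • 1 + |G 1 - t| • lp.single ∞ 1 1) (by
    intro h
    rw [lp.coeFn_add, Pi.add_apply, lp.coeFn_sub, Pi.sub_apply, lp.coeFn_smul, Pi.smul_apply,
      lp.coeFn_smul, Pi.smul_apply, lp.infty_coeFn_one, Pi.one_apply, smul_eq_mul, smul_eq_mul,
      mul_one]
    by_cases hh : h = 1
    · subst hh
      rw [lp.single_apply_self, mul_one]
      linarith [neg_abs_le (G 1 - t)]
    · rw [lp.single_apply_ne _ _ _ hh, mul_zero, hGφ]
      linarith [hsingle h hh])
  rw [map_add, map_sub, map_smul, map_smul, hmG, hone] at hnonneg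
  have hs' : m (lp.single ∞ 1 1) = 0 := by
    convert hsing
  rw [hs', smul_eq_mul, smul_eq_mul] at hnonneg
  linarith

theorem not_hasLocalGap_of_isInnerAmenable (hΓ : IsInnerAmenable Γ) (K : Finset Γ) {κ : ℝ}
    (hκ : 0 < κ) : ¬ HasLocalGap (1 : ell2 Γ →L[ℂ] ell2 Γ) K κ := by
  classical
  intro hgap
  -- Commutators of size at most `c` sum to less than `κ⁻¹`, strictly because of the `+ 1`. The
  -- measure is taken `c ^ 2`-invariant because square roots are used.
  set c : ℝ := (κ * (K.card + 1))⁻¹ with hc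
  have hc0 : 0 < c := by positivity
  obtain ⟨ω, ⟨hω0, hω1, hωe⟩, hω⟩ := exists_almost_invariant_measure hΓ K (pow_pos hc0 2)
  set x : ell2 Γ →L[ℂ] ell2 Γ := ∑ h ∈ ω.support, ((√(ω h) : ℝ) : ℂ) • u h with hx
  have hxL : x ∈ L Γ := sum_mem fun h _ => smul_mem_L _ (u_mem h)
  have hxv : ∀ k, x vacuum k = ((√(ω k) : ℝ) : ℂ) := by
    intro k
    have e : x vacuum = ∑ h ∈ ω.support, ((√(ω h) : ℝ) : ℂ) • basisVec h := by
      rw [hx, sum_apply]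
      refine Finset.sum_congr rfl fun h _ => ?_
      rw [smul_apply, u_vacuum]
    rw [e, lp.coeFn_sum, Finset.sum_apply, Finset.sum_eq_single k]
    · rw [lp.coeFn_smul, Pi.smul_apply, basisVec_apply_self, smul_eq_mul, mul_one]
    · intro h _ hh
      rw [lp.coeFn_smul, Pi.smul_apply, basisVec_apply_ne hh.symm, smul_zero]
    · intro hk
      rw [Finsupp.notMem_support_iff.1 hk]
      simp
  have hτ : τ x = 0 := by
    rw [τ_eq_inner, hxv, hωe]
    simp
  have hN : norm2 x = 1 := by
    have h1 := (hasSum_norm_sq (x vacuum)).tsum_eq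
    have h2 : ∀ k, ‖x vacuum k‖ ^ 2 = ω k := fun k => by
      rw [hxv, Complex.norm_real, Real.norm_of_nonneg (Real.sqrt_nonneg _),
        Real.sq_sqrt (hω0 k)]
    simp only [h2] at h1
    rw [tsum_eq_sum (s := ω.support) fun k hk => Finsupp.notMem_support_iff.1 hk] at h1
    rw [norm2_eq, ← sq_eq_sq₀ (norm_nonneg _) zero_le_one, ← h1, one_pow]
    exact hω1
  have hcomm : ∀ g ∈ K, norm2 (x * u g - u g * x) ≤ c := by
    intro g hg
    refine le_of_sq_le_sq ?_ hc0.le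
    rw [norm2_commutator_u hxL]
    have h1 : ‖Finsupp.linearCombination ℝ (conjDefect K) ω ⟨g, hg⟩‖ ≤ c ^ 2 :=
      (norm_le_pi_norm _ _).trans hω.le
    have h2 := lp.hasSum_norm (p := 1) (by norm_num)
      (Finsupp.linearCombination ℝ (conjDefect K) ω ⟨g, hg⟩)
    simp only [ENNReal.toReal_one, Real.rpow_one, linearCombination_conjDefect_apply] at h2
    refine le_trans (hasSum_le (fun k => ?_) (hasSum_norm_sq _) h2) h1
    rw [lp.coeFn_sub, Pi.sub_apply, conjTranslation_apply, hxv, hxv, ← Complex.ofReal_sub,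
      Complex.norm_real, norm_sub_rev, Real.norm_eq_abs, Real.norm_eq_abs]
    set a := ω (g⁻¹ * k * g)
    set b := ω k
    have ha : √a ^ 2 = a := Real.sq_sqrt (hω0 _)
    have hb : √b ^ 2 = b := Real.sq_sqrt (hω0 _)
    have ha0 := Real.sqrt_nonneg a
    have hb0 := Real.sqrt_nonneg b
    -- The inequality `(√a - √b)² ≤ |a - b|` converts `ℓ¹`-invariance of `ω` into `ℓ²`-invariance of
    -- its square root.
    conv_rhs => rw [← ha, ← hb, sq_sub_sq, abs_mul]
    rw [sq, mul_comm (|√a + √b|)]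
    refine mul_le_mul_of_nonneg_left ?_ (abs_nonneg _)
    rw [abs_of_nonneg (add_nonneg ha0 hb0), abs_le]
    constructor <;> linarith
  have h1 := hgap x hxL (by simp) hτ
  simp only [one_mul, mul_one, hN] at h1
  have h2 := Finset.sum_le_card_nsmul K _ _ hcomm
  rw [nsmul_eq_mul] at h2
  have h3 : κ * ((K.card : ℝ) * c) < 1 := by
    have e : κ * ((K.card + 1 : ℝ) * c) = 1 := by
      rw [hc]
      field_simp
    nlinarith [mul_pos hκ hc0]
  linarith [mul_le_mul_of_nonneg_left h2 hκ.le]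

end InnerAmenable

end GroupFactor

theorem proposition3p3 (Γ : Type u) [Group Γ] (hΓ : GroupFactor.IsICC Γ) :
    (GroupFactor.IsFull Γ →
      ∀ ε : ℝ, 0 < ε →
        ∃ p ∈ GroupFactor.L Γ, IsStarProjection p ∧ GroupFactor.norm2 (1 - p) < ε ∧
          ∃ (K : Finset Γ) (κ : ℝ), 0 < κ ∧ GroupFactor.HasLocalGap p K κ) ∧
    ((∃ (K : Finset Γ) (κ : ℝ), 0 < κ ∧
        GroupFactor.HasLocalGap (1 : GroupFactor.ell2 Γ →L[ℂ] GroupFactor.ell2 Γ) K κ) ↔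
      ¬ GroupFactor.IsInnerAmenable Γ) := by
  refine ⟨fun hfull ε hε => GroupFactor.exists_hasLocalGap_of_isFull hfull hε, ?_,
    GroupFactor.hasLocalGap_of_not_isInnerAmenable⟩
  rintro ⟨K, κ, hκ, hgap⟩ hinner
  exact GroupFactor.not_hasLocalGap_of_isInnerAmenable hinner K hκ hgap
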